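/- For each $n\ge 1$ let $G_n$ be a simple graph on the vertex set $\{1,\dots,n\}$ with adjacency matrix $(a_{uv}(G_n))$ and edge set $E(G_n)$, the vertices being labelled so that their degrees satisfy $d_1\ge d_2\ge\dots\ge d_n$. Let $0<p_n\le 1$ with $p_n\to 0$, put $r_n=1/p_n$, and assume $|E(G_n)|\,p_n^2=\Theta(1)$, that is, there are constants $0<C_1\le C_2$ with $C_1\le |E(G_n)|\,p_n^2\le C_2$ for all large $n$. For each $n$ let $X_1,\dots,X_n$ be i.i.d. $\mathrm{Ber}(p_n)$ and $$T_n=\tfrac12\sum_{u,v=1}^n a_{uv}(G_n)X_uX_v,\qquad T_{n,M}=\tfrac12\sum_{u,v=1}^n a_{uv}(G_n)X_{u,M}X_{v,M},\qquad X_{u,M}=X_u\mathbf 1\{d_u\le M r_n\}\quad(M>0).$$ For $x,y\ge 0$ let $W_{G_n}(x,y)=\mathbf 1\{(\lceil xr_n\rceil,\lceil yr_n\rceil)\in E(G_n)\}$ if $x,y\in[0,n/r_n]$ and $W_{G_n}(x,y)=0$ otherwise, and let $d_{W_{G_n}}(x)=\int_0^\infty W_{G_n}(x,y)\,dy$. For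 $K>0$ and measurable functions $W_1,W_2:[0,\infty)^2\to[0,1]$ let $$\|W_1-W_2\|_{\square([0,K]^2)}=\sup_{f,g:[0,K]\to[-1,1]\text{ measurable}}\Big|\int_{[0,K]^2}(W_1(x,y)-W_2(x,y))f(x)g(y)\,dx\,dy\Big|.$$ The double limit $\lim_{M\to\infty}\lim_{n\to\infty}a_{n,M}=a$ means $\limsup_{M\to\infty}\limsup_{n\to\infty}a_{n,M}=\liminf_{M\to\infty}\liminf_{n\to\infty}a_{n,M}=a$. Let $\lambda\ge 0$, where $\mathrm{Pois}(0)$ is the point mass at $0$. Then the following are equivalent: (a) $T_n\to\mathrm{Pois}(\lambda)$ in distribution. (b) $\lim_{M\to\infty}\lim_{n\to\infty}\mathbb E\,T_{n,M}=\lambda$ and $\lim_{M\to\infty}\lim_{n\to\infty}\mathrm{Var}(T_{n,M})=\lambda$. (c) The following three conditions hold (they are the conditions of the general limit theorem for $T_n$ with $W=0$, $d=0$, $\lambda_0=\lambda$): - $\lim_{K\to\infty}\lim_{n\to\infty}\frac12\int_K^\infty\int_K^\infty W_{G_n}(x,y)\,dx\,dy=\lambda$ (as a double limit in the above sense); - for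 all large enough $K$, $\lim_{n\to\infty}\|W_{G_n}-0\|_{\square([0,K]^2)}=0$; - for all large enough $K,M$, $\lim_{n\to\infty}\int_0^K d_{W_{G_n}}(x)\,\mathbf 1\{d_{W_{G_n}}(x)\le M\}\,dx=0$. -/

import Mathlib

open MeasureTheory ProbabilityTheory Filter Asymptotics
open scoped Topology NNReal unitInterval

namespace BernoulliQuadratic

noncomputable section

/-- The degree `d_v` of the vertex `v`. -/
def deg {n : ℕ} (G : SimpleGraph (Fin n)) (v : Fin n) : ℕ :=
  (G.neighborSet v).ncard

open Classical in
/-- The entry `a_{uv}(G)` of the adjacency matrix of `G`. -/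
def adj {n : ℕ} (G : SimpleGraph (Fin n)) (u v : Fin n) : ℝ :=
  if G.Adj u v then 1 else 0

/-- The quadratic form `½ ∑_{u,v} a_{uv}(G) x_u x_v = ∑_{{u,v} ∈ E(G)} x_u x_v`. -/
def quadForm {n : ℕ} (G : SimpleGraph (Fin n)) (x : Fin n → ℝ) : ℝ :=
  (1 / 2) * ∑ u, ∑ v, adj G u v * x u * x v

open Classical in
/-- The truncated vector with entries `x_u 1{d_u ≤ M r}`. -/
def truncVec {n : ℕ} (G : SimpleGraph (Fin n)) (r M : ℝ) (x : Fin n → ℝ) (u : Fin n) : ℝ :=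
  if (deg G u : ℝ) ≤ M * r then x u else 0

/-- The truncated quadratic form `∑_{{u,v} ∈ E(G)} x_{u,M} x_{v,M}`
with `x_{u,M} = x_u 1{d_u ≤ M r}`. -/
def truncQuadForm {n : ℕ} (G : SimpleGraph (Fin n)) (r M : ℝ) (x : Fin n → ℝ) : ℝ :=
  quadForm G (truncVec G r M x)

/-- The double limit `lim_{M → ∞} lim_{n → ∞} a M n = l`, understood as
`limsup_M limsup_n a M n = liminf_M liminf_n a M n = l`; the upper and lower limits are taken in
the extended reals, where they always exist. -/
def DoubleLimit (a : ℝ → ℕ → ℝ) (l : ℝ) : Prop :=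
  limsup (fun M : ℝ => limsup (fun n : ℕ => (a M n : EReal)) atTop) atTop = (l : EReal) ∧
  liminf (fun M : ℝ => liminf (fun n : ℕ => (a M n : EReal)) atTop) atTop = (l : EReal)

/- Functions on `[0, ∞)` and `[0, ∞)²` are represented by functions on `ℝ` and `ℝ × ℝ`;
their values at negative arguments play no role. -/

/-- Symmetric measurable functions from `[0, ∞)²` to `[0, 1]`. -/
structure IsKernel (W : ℝ → ℝ → ℝ) : Prop where
  measurable : Measurable (fun z : ℝ × ℝ => W z.1 z.2)
  symm : ∀ x y, 0 ≤ x → 0 ≤ y → W x y = W y x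
  mem_Icc : ∀ x y, 0 ≤ x → 0 ≤ y → W x y ∈ Set.Icc (0 : ℝ) 1

open Classical in
/-- The function `W_G(x, y) = 1{(⌈x r⌉, ⌈y r⌉) ∈ E(G)}` on `[0, n/r]²`, extended by `0`, where the
vertices are labelled `1, …, n` (so the element `u` of `Fin n` has the label `u + 1`). If `x` is
not in `(0, n/r]`, then `⌈x r⌉₊` is not the label of a vertex, and the value is `0`. -/
def graphKernel {n : ℕ} (G : SimpleGraph (Fin n)) (r : ℝ) (x y : ℝ) : ℝ :=
  if ∃ u v : Fin n, (u : ℕ) + 1 = ⌈x * r⌉₊ ∧ (v : ℕ) + 1 = ⌈y * r⌉₊ ∧ G.Adj u v then 1 else 0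

/-- The normalized degree function `d_W(x) = ∫_0^∞ W(x, y) dy`. -/
def normDeg (W : ℝ → ℝ → ℝ) (x : ℝ) : ℝ :=
  ∫ y in Set.Ioi (0 : ℝ), W x y

/-- The cut distance of `W₁` and `W₂` restricted to `[0, K]²`: the supremum of
`|∫_{[0,K]²} (W₁(x,y) - W₂(x,y)) f(x) g(y) dx dy|` over all measurable `f, g` with values in
`[-1, 1]`. -/
def cutDist (K : ℝ) (W₁ W₂ : ℝ → ℝ → ℝ) : ℝ :=
  sSup {c : ℝ | ∃ f g : ℝ → ℝ, Measurable f ∧ Measurable g ∧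
    (∀ x, f x ∈ Set.Icc (-1 : ℝ) 1) ∧ (∀ y, g y ∈ Set.Icc (-1 : ℝ) 1) ∧
    c = |∫ z in Set.Icc (0 : ℝ) K ×ˢ Set.Icc (0 : ℝ) K,
          (W₁ z.1 z.2 - W₂ z.1 z.2) * f z.1 * g z.2|}

open Classical in
/-- The truncated function `d(x) 1{d(x) ≤ M}`. -/
def truncFun (M : ℝ) (d : ℝ → ℝ) (x : ℝ) : ℝ :=
  if d x ≤ M then d x else 0

/-- The hypotheses of the general limit theorem for `Tₙ`, with limiting kernel `W`, limiting
degree function `d` and residual Poisson parameter `lam₀`, where `r n = 1 / pₙ`. -/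
structure LimitHypotheses (G : (n : ℕ) → SimpleGraph (Fin n)) (r : ℕ → ℝ)
    (W : ℝ → ℝ → ℝ) (d : ℝ → ℝ) (lam₀ : ℝ) : Prop where
  /-- The mass of the kernels far away from the axes converges to `lam₀`. -/
  residual : DoubleLimit
    (fun K n => (1 / 2) *
      ∫ x in Set.Ioi K, ∫ y in Set.Ioi K, graphKernel (G n) (r n) x y) lam₀
  kernel : IsKernel W
  /-- `W_{Gₙ}` converges to `W` in cut distance on `[0, K]²` for all large `K`. -/
  tendsto_cutDist : ∃ K₀ : ℝ, 0 < K₀ ∧ ∀ K ≥ K₀,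
    Tendsto (fun n => cutDist K (graphKernel (G n) (r n)) W) atTop (𝓝 0)
  deg_measurable : Measurable d
  deg_nonneg : ∀ x, 0 ≤ x → 0 ≤ d x
  deg_integrable : IntegrableOn d (Set.Ici 0)
  /-- The truncated normalized degrees converge to the truncation of `d` in `L₁([0, K])`, for all
  large `K` and `M`. -/
  tendsto_deg : ∃ K₀ M₀ : ℝ, 0 < K₀ ∧ 0 < M₀ ∧ ∀ K ≥ K₀, ∀ M ≥ M₀,
    Tendsto (fun n => ∫ x in Set.Icc (0 : ℝ) K,
      |truncFun M (normDeg (graphKernel (G n) (r n))) x - truncFun M d x|) atTop (𝓝 0)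

end

end BernoulliQuadratic

/-! Write `μ` for the mean `edgeMass` of the form and `S` for `pathMass`, that is, `p³` times the
sum of the squared degrees. Expanding the square gives the variance `(1 - p) S + (1 - p)² μ`. As `p
→ 0` with `μ` bounded, mean and variance therefore agree asymptotically exactly when `S → 0`. All
three conditions reduce to two statements on the truncated graphs: `S → 0` for every fixed
truncation level `M`, and `μ` has double limit `λ`.

These two statements force a Poisson limit. Conditioning on the presence of an edge shifts the form
`T` by one, up to the edges meeting it, so `E[T exp(itT)]` equals `μ exp(it) E[exp(itT)]` up to `3
|t| S`. With error zero this is the differential equation of the Poisson characteristic function,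
and integrating it gives `norm_integral_cexp_sub_le`. Truncation is harmless: by Markov's inequality
the expected number of chosen vertices of degree above `M / p` is at most `2 μ / M`
(`norm_integral_sub_truncated_le`).

Conversely, Poisson convergence passes to the first two moments of the truncated forms, because
bounded degrees keep the third moment bounded in `n` (`integral_matrixForm_cube_le`,
`eventually_abs_integral_pow_sub_lt`).

On the kernel side, `W` is constant on squares of side `p`, so its integrals are the finite sums
`farMass`, `nearDeg` and `nearMass`. Since the degrees are sorted, a vertex whose cell reaches
beyond `K` has normalized degree at most `2C / K`. Hence `S` and `nearDeg` control each other
(`pathMass_le_nearDeg`, `nearDeg_le_pathMass`), `farMass` and the truncated mean differ by at most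
`nearDeg` (`abs_edgeMass_sub_farMass_le`), and the cut norm is bounded by `nearDeg` and a term of
order `M⁻²` (`nearMass_le_nearDeg`). -/

namespace BernoulliQuadratic

noncomputable section

/-! ### Independent Bernoulli variables and expectations of their products. -/

/-- A finite family of independent Bernoulli variables with parameter `p`. -/
structure IsBernoulliFamily {n : ℕ} {Ω : Type*} [MeasurableSpace Ω] (p : ℝ) (X : Fin n → Ω → ℝ)
    (P : Measure Ω) : Prop where
  aemeasurable : ∀ v, AEMeasurable (X v) P
  zero_or_one : ∀ᵐ ω ∂P, ∀ v, X v ω = 0 ∨ X v ω = 1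
  integral_eq : ∀ v, ∫ ω, X v ω ∂P = p
  indep : iIndepFun X P

section Family

variable {n : ℕ} {Ω : Type*} [MeasurableSpace Ω] {p : ℝ} {X : Fin n → Ω → ℝ} {P : Measure Ω}

lemma isBernoulliFamily_of_hasLaw {q : I} (hX : ∀ v, HasLaw (X v) (bernoulliMeasure (1 : ℝ) 0 q) P)
    (hind : iIndepFun X P) : IsBernoulliFamily (q : ℝ) X P where
  aemeasurable v := (hX v).aemeasurable
  zero_or_one := by
    rw [ae_all_iff]
    intro v
    have hm : Measurable (fun x : ℝ => x = 0 ∨ x = 1) :=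
      measurableSet_setOfPred.1 ((measurableSet_singleton 0).union (measurableSet_singleton 1))
    rw [(hX v).ae_iff (p := fun x => x = 0 ∨ x = 1) hm, ae_iff,
      bernoulliMeasure_apply_of_notMem_of_notMem]
    case hs => exact (measurableSet_setOfPred.2 hm).compl
    all_goals simp
  integral_eq v := by
    have h := (hX v).integral_comp (f := fun x : ℝ => x) (by fun_prop)
    rw [integral_bernoulliMeasure] at h
    simpa [Function.comp_def] using h
  indep := hind

namespace IsBernoulliFamily

lemma isProbabilityMeasure (h : IsBernoulliFamily p X P) : IsProbabilityMeasure P :=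
  h.indep.isProbabilityMeasure

lemma aemeasurable_pi (h : IsBernoulliFamily p X P) : AEMeasurable (fun ω v => X v ω) P :=
  aemeasurable_pi_lambda _ h.aemeasurable

/-- Continuous functions of a Bernoulli family are integrable. -/
lemma integrable_comp {E : Type*} [NormedAddCommGroup E] [SecondCountableTopology E]
    (h : IsBernoulliFamily p X P) {f : (Fin n → ℝ) → E} (hf : Continuous f) :
    Integrable (fun ω => f (fun v => X v ω)) P := by
  have := h.isProbabilityMeasure
  borelize E
  have hc : IsCompact (Set.Icc (0 : Fin n → ℝ) 1) := isCompact_Icc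
  obtain ⟨C, hC⟩ := hc.exists_bound_of_continuousOn hf.continuousOn
  refine Integrable.of_bound (hf.measurable.comp_aemeasurable h.aemeasurable_pi).aestronglyMeasurable
    C ?_
  filter_upwards [h.zero_or_one] with ω hω
  refine hC _ ⟨fun v => ?_, fun v => ?_⟩ <;> rcases hω v with h0 | h0 <;> simp [h0]

/-- Integrals of products of distinct variables. -/
lemma integral_prod (h : IsBernoulliFamily p X P) (S : Finset (Fin n)) :
    ∫ ω, ∏ u ∈ S, X u ω ∂P = p ^ S.card := by
  classical
  have := h.isProbabilityMeasure
  have h1 := h.indep.integral_fun_prod_comp (f := fun u x => if u ∈ S then x else 1) h.aemeasurable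
    (fun u => by by_cases hu : u ∈ S <;> simp only [hu, if_true, if_false] <;> fun_prop)
  have h2 : ∀ ω, ∏ u, (if u ∈ S then X u ω else 1) = ∏ u ∈ S, X u ω := by
    intro ω
    rw [Finset.prod_ite_mem, Finset.univ_inter]
  have h3 : ∀ u, ∫ ω, (if u ∈ S then X u ω else 1) ∂P = if u ∈ S then p else 1 := by
    intro u
    by_cases hu : u ∈ S <;> simp [hu, h.integral_eq]
  simp only [h2, h3] at h1
  rw [h1, Finset.prod_ite_mem, Finset.univ_inter, Finset.prod_const]

/-- A product of distinct variables factors out of an expectation that does not involve them. -/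
lemma integral_prod_mul (h : IsBernoulliFamily p X P) (S : Finset (Fin n))
    {f : (Fin n → ℝ) → ℂ} (hf : Continuous f) :
    ∫ ω, ((∏ u ∈ S, X u ω : ℝ) : ℂ) * f (fun v => if v ∈ S then 0 else X v ω) ∂P
      = (p : ℂ) ^ S.card * ∫ ω, f (fun v => if v ∈ S then 0 else X v ω) ∂P := by
  classical
  have hi := h.indep.indepFun_finset₀ S Sᶜ disjoint_compl_right h.aemeasurable
  let φ : (S → ℝ) → ℂ := fun y => ((∏ u : S, y u : ℝ) : ℂ)
  let ψ : ((Sᶜ : Finset (Fin n)) → ℝ) → ℂ := fun y =>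
    f (fun v => if hv : v ∈ S then 0 else y ⟨v, Finset.mem_compl.2 hv⟩)
  have hφ : Continuous φ := by fun_prop
  have hψ : Continuous ψ := by
    refine hf.comp (continuous_pi fun v => ?_)
    by_cases hv : v ∈ S <;> simp only [hv, dif_pos, dif_neg, not_false_eq_true] <;> fun_prop
  have key := hi.integral_fun_comp_mul_comp (f := φ) (g := ψ)
    (aemeasurable_pi_lambda _ fun u => h.aemeasurable _)
    (aemeasurable_pi_lambda _ fun u => h.aemeasurable _)
    hφ.aestronglyMeasurable hψ.aestronglyMeasurable
  have e1 : ∀ ω, φ (fun u : S => X u ω) = ((∏ u ∈ S, X u ω : ℝ) : ℂ) := fun ω => by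
    simp only [φ]
    rw [Finset.prod_coe_sort S (fun u => X u ω)]
  have e2 : ∀ ω, ψ (fun u : (Sᶜ : Finset (Fin n)) => X u ω)
      = f (fun v => if v ∈ S then 0 else X v ω) := fun ω => by
    simp only [ψ, dite_eq_ite]
  simp only [e1, e2] at key
  rw [key, integral_complex_ofReal, h.integral_prod]
  push_cast
  rfl

end IsBernoulliFamily

/-- Since `x² = x` for `x ∈ {0, 1}`, repeated factors can be dropped. Every mixed moment is thus `p`
to the number of distinct indices. -/
lemma mul_prod_eq_prod_insert {x : Fin n → ℝ} (hx : ∀ v, x v = 0 ∨ x v = 1) (u : Fin n)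
    (S : Finset (Fin n)) : x u * ∏ v ∈ S, x v = ∏ v ∈ insert u S, x v := by
  by_cases hu : u ∈ S
  · rw [Finset.insert_eq_of_mem hu, ← Finset.mul_prod_erase S x hu, ← mul_assoc]
    rcases hx u with h | h <;> simp [h]
  · rw [Finset.prod_insert hu]

namespace IsBernoulliFamily

lemma integral_mul_prod (h : IsBernoulliFamily p X P) (u v : Fin n) (S : Finset (Fin n)) :
    ∫ ω, X u ω * X v ω * ∏ w ∈ S, X w ω ∂P = p ^ (insert u (insert v S)).card := by
  rw [← h.integral_prod]
  refine integral_congr_ae ?_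
  filter_upwards [h.zero_or_one] with ω hω
  rw [mul_assoc, mul_prod_eq_prod_insert hω, mul_prod_eq_prod_insert hω]

lemma integral_mul (h : IsBernoulliFamily p X P) {u v : Fin n} (huv : u ≠ v) :
    ∫ ω, X u ω * X v ω ∂P = p ^ 2 := by
  have := h.integral_mul_prod u v ∅
  simpa [Finset.card_pair huv] using this

lemma integral_mul_mul (h : IsBernoulliFamily p X P) (u v x y : Fin n) :
    ∫ ω, (X u ω * X v ω) * (X x ω * X y ω) ∂P = p ^ ({u, v, x, y} : Finset (Fin n)).card := by
  rw [← h.integral_mul_prod]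
  refine integral_congr_ae ?_
  filter_upwards [h.zero_or_one] with ω hω
  have h1 := mul_prod_eq_prod_insert hω x {y}
  rw [Finset.prod_singleton] at h1
  rw [h1]

lemma integral_mul_mul_mul (h : IsBernoulliFamily p X P) (u v x y s t : Fin n) :
    ∫ ω, (X u ω * X v ω) * ((X x ω * X y ω) * (X s ω * X t ω)) ∂P
      = p ^ ({u, v, x, y, s, t} : Finset (Fin n)).card := by
  rw [← h.integral_mul_prod]
  refine integral_congr_ae ?_
  filter_upwards [h.zero_or_one] with ω hω
  have h1 := mul_prod_eq_prod_insert hω s {t}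
  have h2 := mul_prod_eq_prod_insert hω y {s, t}
  have h3 := mul_prod_eq_prod_insert hω x {y, s, t}
  rw [Finset.prod_singleton] at h1
  rw [← h3, ← h2, ← h1, mul_assoc (X x ω)]

end IsBernoulliFamily

end Family

/-! ### Adjacency matrices and counts of overlapping edges. -/

/-- Symmetric matrices with entries `0` and `1` and zero diagonal. -/
structure IsAdjacency {n : ℕ} (b : Fin n → Fin n → ℝ) : Prop where
  symm : ∀ u v, b u v = b v u
  diag : ∀ u, b u u = 0
  zero_or_one : ∀ u v, b u v = 0 ∨ b u v = 1

/-- The quadratic form `½ ∑_{u,v} b_{uv} x_u x_v`. -/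
def matrixForm {n : ℕ} (b : Fin n → Fin n → ℝ) (x : Fin n → ℝ) : ℝ :=
  (1 / 2) * ∑ u, ∑ v, b u v * x u * x v

/-- The row sums of a matrix. -/
def rowSum {n : ℕ} (b : Fin n → Fin n → ℝ) (u : Fin n) : ℝ := ∑ v, b u v

/-- The expected number of edges spanned by a random set of vertices of density `p`. -/
def edgeMass {n : ℕ} (b : Fin n → Fin n → ℝ) (p : ℝ) : ℝ := (1 / 2) * ∑ u, ∑ v, b u v * p ^ 2

/-- The sum of the squared degrees, in the normalization of the number of spanned paths. -/
def pathMass {n : ℕ} (b : Fin n → Fin n → ℝ) (p : ℝ) : ℝ := p ^ 3 * ∑ u, rowSum b u ^ 2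

@[fun_prop]
lemma continuous_matrixForm {n : ℕ} (b : Fin n → Fin n → ℝ) : Continuous (matrixForm b) := by
  unfold matrixForm
  fun_prop

section Matrix

variable {n : ℕ} {b : Fin n → Fin n → ℝ}

namespace IsAdjacency

lemma nonneg (hb : IsAdjacency b) (u v : Fin n) : 0 ≤ b u v := by
  rcases hb.zero_or_one u v with h | h <;> simp [h]

lemma le_one (hb : IsAdjacency b) (u v : Fin n) : b u v ≤ 1 := by
  rcases hb.zero_or_one u v with h | h <;> simp [h]

lemma mul_self (hb : IsAdjacency b) (u v : Fin n) : b u v * b u v = b u v := by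
  rcases hb.zero_or_one u v with h | h <;> simp [h]

lemma rowSum_nonneg (hb : IsAdjacency b) (u : Fin n) : 0 ≤ rowSum b u :=
  Finset.sum_nonneg fun v _ => hb.nonneg u v

lemma matrixForm_nonneg (hb : IsAdjacency b) {x : Fin n → ℝ} (hx : ∀ v, 0 ≤ x v) :
    0 ≤ matrixForm b x :=
  mul_nonneg (by norm_num) <| Finset.sum_nonneg fun u _ => Finset.sum_nonneg fun v _ =>
    mul_nonneg (mul_nonneg (hb.nonneg u v) (hx u)) (hx v)

lemma edgeMass_nonneg (hb : IsAdjacency b) (p : ℝ) : 0 ≤ edgeMass b p :=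
  mul_nonneg (by norm_num) <| Finset.sum_nonneg fun u _ => Finset.sum_nonneg fun v _ =>
    mul_nonneg (hb.nonneg u v) (sq_nonneg p)

lemma pathMass_nonneg {p : ℝ} (hp : 0 ≤ p) : 0 ≤ pathMass b p := by
  unfold pathMass
  positivity

end IsAdjacency

lemma sum_mul_rowSum (b : Fin n → Fin n → ℝ) :
    ∑ u, ∑ v, b u v * rowSum b u = ∑ u, rowSum b u ^ 2 := by
  refine Finset.sum_congr rfl fun u _ => ?_
  rw [← Finset.sum_mul, sq, rowSum]

lemma IsAdjacency.sum_mul_rowSum_right (hb : IsAdjacency b) :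
    ∑ u, ∑ v, b u v * rowSum b v = ∑ u, rowSum b u ^ 2 := by
  rw [Finset.sum_comm, ← sum_mul_rowSum]
  simp only [hb.symm]

/-- Two genuine pairs have zero, one or two coincidences, giving `p ^ 4`, `p ^ 3`, `p ^ 2`. Each
coincidence adds `p ^ 3 - p ^ 4`; with two of them the last coefficient corrects the total to `p ^
2`. This form is linear in indicators and can be summed. -/
lemma pow_card_four (p : ℝ) {u v x y : Fin n} (huv : u ≠ v) (hxy : x ≠ y) :
    p ^ ({u, v, x, y} : Finset (Fin n)).card = p ^ 4
      + (p ^ 3 - p ^ 4) * ((if u = x then 1 else 0) + (if u = y then 1 else 0)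
        + (if v = x then 1 else 0) + (if v = y then 1 else 0))
      + (p ^ 2 - 2 * p ^ 3 + p ^ 4) * ((if u = x then if v = y then 1 else 0 else 0)
        + (if u = y then if v = x then 1 else 0 else 0)) := by
  by_cases h1 : u = x <;> by_cases h2 : u = y <;> by_cases h3 : v = x <;> by_cases h4 : v = y <;>
    first
    | (exfalso; grind)
    | (simp [h1, h2, h3, h4, Finset.card_insert_of_notMem, huv, hxy, Finset.mem_insert] <;> grind)
-- Of the ordered pairs of oriented edges, the four ways to identify one endpoint each contribute
-- the sum of squared degrees, and the two ways to identify both each contribute the sum of entries,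
-- because `b² = b`.
lemma IsAdjacency.sum_mul_pow_card_four (hb : IsAdjacency b) (p : ℝ) :
    ∑ u, ∑ v, ∑ x, ∑ y, b u v * b x y * p ^ ({u, v, x, y} : Finset (Fin n)).card
      = p ^ 4 * (∑ u, ∑ v, b u v) ^ 2 + 4 * (p ^ 3 - p ^ 4) * ∑ u, rowSum b u ^ 2
        + 2 * (p ^ 2 - 2 * p ^ 3 + p ^ 4) * ∑ u, ∑ v, b u v := by
  have key : ∀ u v, ∑ x, ∑ y, b u v * b x y * p ^ ({u, v, x, y} : Finset (Fin n)).card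
      = p ^ 4 * (∑ x, ∑ y, b x y) * b u v
        + 2 * (p ^ 3 - p ^ 4) * (b u v * rowSum b u + b u v * rowSum b v)
        + 2 * (p ^ 2 - 2 * p ^ 3 + p ^ 4) * b u v := by
    intro u v
    by_cases huv : u = v
    · subst huv
      simp [hb.diag]
    have h1 : ∀ x y, b u v * b x y * p ^ ({u, v, x, y} : Finset (Fin n)).card
        = b u v * (p ^ 4 * b x y + (p ^ 3 - p ^ 4) * ((if u = x then b x y else 0)
          + (if u = y then b x y else 0) + (if v = x then b x y else 0)
          + (if v = y then b x y else 0))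
          + (p ^ 2 - 2 * p ^ 3 + p ^ 4) * ((if u = x then if v = y then b x y else 0 else 0)
          + (if v = x then if u = y then b x y else 0 else 0))) := by
      intro x y
      by_cases hxy : x = y
      · subst hxy
        simp [hb.diag]
      rw [pow_card_four p huv hxy]
      split_ifs <;> ring
    simp only [h1, ← Finset.mul_sum, Finset.sum_add_distrib, Finset.sum_ite_eq, Finset.mem_univ,
      if_true]
    have h2 : ∀ u, ∑ x, ∑ y, (if u = x then b x y else 0) = rowSum b u := by
      intro u
      rw [Finset.sum_comm]
      simp [rowSum]
    have h3 : ∀ u, ∑ x, b x u = rowSum b u := fun u => by simp only [rowSum, hb.symm u]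
    have h4 : ∀ u v, ∑ x, ∑ y, (if u = x then if v = y then b x y else 0 else 0) = b u v := by
      intro u v
      rw [Finset.sum_comm]
      simp
    rw [h2, h2, h3, h3, h4, h4, hb.symm v u]
    linear_combination (2 * (p ^ 2 - 2 * p ^ 3 + p ^ 4)) * hb.mul_self u v
  simp only [key, Finset.sum_add_distrib, ← Finset.mul_sum]
  rw [sum_mul_rowSum, hb.sum_mul_rowSum_right]
  ring

/-- One step of the recursion for moments: adding an edge to a set of vertices. -/
lemma IsAdjacency.sum_mul_pow_card_le (hb : IsAdjacency b) {p M : ℝ} (hp : 0 ≤ p)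
    (hM : ∀ u, p * rowSum b u ≤ M) (S : Finset (Fin n)) :
    ∑ s, ∑ t, b s t * p ^ (insert s (insert t S)).card
      ≤ p ^ S.card * (2 * edgeMass b p + 2 * S.card * M + (S.card : ℝ) ^ 2) := by
  -- Cases by the endpoints lying in `S`: two new vertices cost `p ^ 2`, one new vertex costs `p`
  -- and leaves a row sum of at most `M / p`, and no new vertex costs nothing but allows only
  -- `S.card ^ 2` pairs.
  have h1 : ∀ s t, b s t * p ^ (insert s (insert t S)).card
      ≤ p ^ S.card * (b s t * p ^ 2 + (if s ∈ S then p * b s t else 0)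
        + (if t ∈ S then p * b s t else 0)
        + (if s ∈ S then if t ∈ S then 1 else 0 else 0)) := by
    intro s t
    by_cases hst : s = t
    · subst hst
      rw [hb.diag]
      split_ifs <;> simp <;> positivity
    have h2 : 0 ≤ p ^ S.card := by positivity
    rcases hb.zero_or_one s t with h0 | h0
    · rw [h0]
      split_ifs <;> simp [h2]
    rw [h0]
    by_cases hs : s ∈ S <;> by_cases ht : t ∈ S
    · rw [Finset.insert_eq_of_mem ht, Finset.insert_eq_of_mem hs]
      simp only [hs, ht, if_true]
      nlinarith [mul_nonneg h2 hp, mul_nonneg h2 (sq_nonneg p)]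
    · rw [Finset.insert_comm, Finset.insert_eq_of_mem hs, Finset.card_insert_of_notMem ht]
      simp only [hs, ht, if_true, if_false, pow_succ]
      nlinarith [mul_nonneg h2 hp, mul_nonneg h2 (sq_nonneg p)]
    · rw [Finset.insert_eq_of_mem ht, Finset.card_insert_of_notMem hs]
      simp only [hs, ht, if_true, if_false, pow_succ]
      nlinarith [mul_nonneg h2 hp, mul_nonneg h2 (sq_nonneg p)]
    · rw [Finset.card_insert_of_notMem (by simp [hst, hs]), Finset.card_insert_of_notMem ht]
      simp only [hs, ht, if_false, pow_succ]
      linarith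
  refine (Finset.sum_le_sum fun s _ => Finset.sum_le_sum fun t _ => h1 s t).trans ?_
  simp only [← Finset.mul_sum, Finset.sum_add_distrib]
  refine mul_le_mul_of_nonneg_left ?_ (by positivity)
  have h3 : ∑ s, ∑ t, (if s ∈ S then p * b s t else 0) ≤ S.card * M := by
    have : ∀ s, ∑ t, (if s ∈ S then p * b s t else 0) = if s ∈ S then p * rowSum b s else 0 := by
      intro s
      split_ifs <;> simp [rowSum, Finset.mul_sum]
    simp only [this, Finset.sum_ite_mem, Finset.univ_inter]
    exact (Finset.sum_le_card_nsmul _ _ _ fun u _ => hM u).trans (by simp)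
  have h4 : ∑ s, ∑ t, (if t ∈ S then p * b s t else 0) ≤ S.card * M := by
    rw [Finset.sum_comm]
    simpa only [hb.symm] using h3
  have h5 : ∑ s, ∑ t, (if s ∈ S then if t ∈ S then (1 : ℝ) else 0 else 0) = (S.card : ℝ) ^ 2 := by
    have : ∀ s, ∑ t, (if s ∈ S then if t ∈ S then (1 : ℝ) else 0 else 0)
        = if s ∈ S then (S.card : ℝ) else 0 := by
      intro s
      split_ifs <;> simp
    simp only [this, Finset.sum_ite_mem, Finset.univ_inter]
    simp [sq]
  rw [h5, edgeMass]
  linarith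

/-- Removing two vertices from a quadratic form. -/
lemma IsAdjacency.matrixForm_eq_add (hb : IsAdjacency b) {u v : Fin n} (huv : u ≠ v)
    (x : Fin n → ℝ) :
    matrixForm b x = matrixForm b (fun w => if w ∈ ({u, v} : Finset (Fin n)) then 0 else x w)
      + x u * (∑ y, b u y * if y ∈ ({u, v} : Finset (Fin n)) then 0 else x y)
      + x v * (∑ y, b v y * if y ∈ ({u, v} : Finset (Fin n)) then 0 else x y)
      + b u v * x u * x v := by
  set x' : Fin n → ℝ := fun w => if w ∈ ({u, v} : Finset (Fin n)) then 0 else x w with hx'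
  -- Splitting `x` into the part off `{u, v}` and its two remaining entries; the claim is then
  -- bilinearity with symmetry and zero diagonal.
  have hx : ∀ w, x w = x' w + ((if u = w then x u else 0) + if v = w then x v else 0) := by
    intro w
    simp only [hx', Finset.mem_insert, Finset.mem_singleton]
    grind
  have hA : ∀ s, ∑ t, b s t * x t = ∑ t, b s t * x' t + (b s u * x u + b s v * x v) := by
    intro s
    conv_lhs => enter [2, t]; rw [hx t]
    simp [mul_add, Finset.sum_add_distrib]
  have hB : ∀ y : Fin n → ℝ, matrixForm b y = 1 / 2 * ∑ s, y s * ∑ t, b s t * y t := by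
    intro y
    simp only [matrixForm, Finset.mul_sum]
    exact Finset.sum_congr rfl fun s _ => Finset.sum_congr rfl fun t _ => by ring
  have hC : ∀ g : Fin n → ℝ, ∑ s, x s * g s = ∑ s, x' s * g s + (x u * g u + x v * g v) := by
    intro g
    conv_lhs => enter [2, s]; rw [hx s]
    simp [add_mul, Finset.sum_add_distrib]
  have hD : ∀ w, ∑ s, x' s * b s w = ∑ t, b w t * x' t := fun w =>
    Finset.sum_congr rfl fun s _ => by rw [hb.symm, mul_comm]
  rw [hB, hC, hB]
  simp only [hA, mul_add, Finset.sum_add_distrib]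
  simp only [← mul_assoc, ← Finset.sum_mul, hD, hb.diag, hb.symm v u]
  ring

end Matrix

/-! ### First, second and third moments of the form. -/

section Moments

variable {n : ℕ} {Ω : Type*} [MeasurableSpace Ω] {p : ℝ} {X : Fin n → Ω → ℝ} {P : Measure Ω}
  {b : Fin n → Fin n → ℝ}

lemma matrixForm_sq (b : Fin n → Fin n → ℝ) (x : Fin n → ℝ) : matrixForm b x ^ 2
    = 1 / 4 * ∑ u, ∑ v, ∑ s, ∑ t, b u v * b s t * ((x u * x v) * (x s * x t)) := by
  have h : matrixForm b x ^ 2 = 1 / 4 * ((∑ u, ∑ v, b u v * x u * x v)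
      * (∑ u, ∑ v, b u v * x u * x v)) := by
    rw [matrixForm]; ring
  rw [h]
  simp only [Finset.sum_mul, Finset.mul_sum]
  refine Finset.sum_congr rfl fun u _ => Finset.sum_congr rfl fun v _ =>
    Finset.sum_congr rfl fun s _ => Finset.sum_congr rfl fun t _ => by ring

lemma matrixForm_cube (b : Fin n → Fin n → ℝ) (x : Fin n → ℝ) : matrixForm b x ^ 3
    = 1 / 8 * ∑ i, ∑ j, ∑ u, ∑ v, ∑ s, ∑ t, b i j * b u v * b s t
      * ((x s * x t) * ((x u * x v) * (x i * x j))) := by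
  have h : matrixForm b x ^ 3 = 1 / 8 * ((∑ u, ∑ v, b u v * x u * x v)
      * ((∑ u, ∑ v, b u v * x u * x v) * (∑ u, ∑ v, b u v * x u * x v))) := by
    rw [matrixForm]; ring
  rw [h]
  simp only [Finset.sum_mul, Finset.mul_sum]
  refine Finset.sum_congr rfl fun u _ => Finset.sum_congr rfl fun v _ =>
    Finset.sum_congr rfl fun s _ => Finset.sum_congr rfl fun t _ =>
    Finset.sum_congr rfl fun i _ => Finset.sum_congr rfl fun j _ => by ring

namespace IsBernoulliFamily

lemma integral_matrixForm (h : IsBernoulliFamily p X P) (hb : IsAdjacency b) :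
    ∫ ω, matrixForm b (fun v => X v ω) ∂P = edgeMass b p := by
  simp only [matrixForm, edgeMass]
  rw [integral_const_mul, integral_finsetSum _ fun u _ =>
    h.integrable_comp (f := fun x => ∑ v, b u v * x u * x v) (by fun_prop)]
  congr 1
  refine Finset.sum_congr rfl fun u _ => ?_
  rw [integral_finsetSum _ fun v _ =>
    h.integrable_comp (f := fun x => b u v * x u * x v) (by fun_prop)]
  refine Finset.sum_congr rfl fun v _ => ?_
  by_cases huv : u = v
  · simp [huv, hb.diag]
  · simp only [mul_assoc]
    rw [integral_const_mul, h.integral_mul huv]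

/-- `pathMass` sums `d²` rather than `d (d - 1)`, so it also counts each edge paired with itself.
Removing this surplus turns the natural factor `1 - p ^ 2` of `edgeMass` into `(1 - p) ^ 2`. -/
lemma integral_matrixForm_sq (h : IsBernoulliFamily p X P) (hb : IsAdjacency b) :
    ∫ ω, matrixForm b (fun v => X v ω) ^ 2 ∂P
      = edgeMass b p ^ 2 + (1 - p) * pathMass b p + edgeMass b p * (1 - p) ^ 2 := by
  have h1 : ∫ ω, matrixForm b (fun v => X v ω) ^ 2 ∂P = 1 / 4 *
      ∑ u, ∑ v, ∑ s, ∑ t, b u v * b s t * p ^ ({u, v, s, t} : Finset (Fin n)).card := by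
    simp only [matrixForm_sq]
    rw [integral_const_mul]
    congr 1
    rw [integral_finsetSum _ fun u _ => h.integrable_comp (f := fun x => ∑ v, ∑ s, ∑ t,
      b u v * b s t * ((x u * x v) * (x s * x t))) (by fun_prop)]
    refine Finset.sum_congr rfl fun u _ => ?_
    rw [integral_finsetSum _ fun v _ => h.integrable_comp (f := fun x => ∑ s, ∑ t,
      b u v * b s t * ((x u * x v) * (x s * x t))) (by fun_prop)]
    refine Finset.sum_congr rfl fun v _ => ?_
    rw [integral_finsetSum _ fun s _ => h.integrable_comp (f := fun x => ∑ t,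
      b u v * b s t * ((x u * x v) * (x s * x t))) (by fun_prop)]
    refine Finset.sum_congr rfl fun s _ => ?_
    rw [integral_finsetSum _ fun t _ => h.integrable_comp (f := fun x =>
      b u v * b s t * ((x u * x v) * (x s * x t))) (by fun_prop)]
    refine Finset.sum_congr rfl fun t _ => ?_
    rw [integral_const_mul, h.integral_mul_mul]
  rw [h1, hb.sum_mul_pow_card_four, edgeMass, pathMass]
  simp only [← Finset.sum_mul]
  ring

/-- The variance of the number of edges spanned by a random set of vertices. -/
lemma variance_matrixForm (h : IsBernoulliFamily p X P) (hb : IsAdjacency b) :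
    variance (fun ω => matrixForm b (fun v => X v ω)) P
      = (1 - p) * pathMass b p + edgeMass b p * (1 - p) ^ 2 := by
  have := h.isProbabilityMeasure
  have hm := (h.integrable_comp (continuous_matrixForm b)).aestronglyMeasurable
  rw [variance_eq_sub
    ((memLp_two_iff_integrable_sq hm).2 (h.integrable_comp (f := fun x => matrixForm b x ^ 2)
      (by fun_prop)))]
  have := h.integral_matrixForm_sq hb
  simp only [Pi.pow_apply]
  rw [this, h.integral_matrixForm hb]
  ring

/-- The three edges are added one at a time. At most four vertices are present before the last one,
so each step costs at most the factor obtained from `sum_mul_pow_card_le` with `S.card = 4`: `8 M =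
2 · 4 · M` and `16 = 4 ^ 2`. The bound depends on `n` only through `edgeMass` and will give uniform
integrability. -/
lemma integral_matrixForm_cube_le (h : IsBernoulliFamily p X P) (hb : IsAdjacency b)
    (hp : 0 ≤ p) {M : ℝ} (hM0 : 0 ≤ M) (hM : ∀ u, p * rowSum b u ≤ M) :
    ∫ ω, matrixForm b (fun v => X v ω) ^ 3 ∂P ≤ (2 * edgeMass b p + 8 * M + 16) ^ 3 := by
  have h1 : ∫ ω, matrixForm b (fun v => X v ω) ^ 3 ∂P = 1 / 8 *
      ∑ i, ∑ j, ∑ u, ∑ v, ∑ s, ∑ t, b i j * b u v * b s t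
        * p ^ ({s, t, u, v, i, j} : Finset (Fin n)).card := by
    simp only [matrixForm_cube]
    rw [integral_const_mul]
    congr 1
    rw [integral_finsetSum _ fun i _ => h.integrable_comp (f := fun x => ∑ j, ∑ u, ∑ v, ∑ s, ∑ t,
      b i j * b u v * b s t * ((x s * x t) * ((x u * x v) * (x i * x j)))) (by fun_prop)]
    refine Finset.sum_congr rfl fun i _ => ?_
    rw [integral_finsetSum _ fun j _ => h.integrable_comp (f := fun x => ∑ u, ∑ v, ∑ s, ∑ t,
      b i j * b u v * b s t * ((x s * x t) * ((x u * x v) * (x i * x j)))) (by fun_prop)]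
    refine Finset.sum_congr rfl fun j _ => ?_
    rw [integral_finsetSum _ fun u _ => h.integrable_comp (f := fun x => ∑ v, ∑ s, ∑ t,
      b i j * b u v * b s t * ((x s * x t) * ((x u * x v) * (x i * x j)))) (by fun_prop)]
    refine Finset.sum_congr rfl fun u _ => ?_
    rw [integral_finsetSum _ fun v _ => h.integrable_comp (f := fun x => ∑ s, ∑ t,
      b i j * b u v * b s t * ((x s * x t) * ((x u * x v) * (x i * x j)))) (by fun_prop)]
    refine Finset.sum_congr rfl fun v _ => ?_
    rw [integral_finsetSum _ fun s _ => h.integrable_comp (f := fun x => ∑ t,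
      b i j * b u v * b s t * ((x s * x t) * ((x u * x v) * (x i * x j)))) (by fun_prop)]
    refine Finset.sum_congr rfl fun s _ => ?_
    rw [integral_finsetSum _ fun t _ => h.integrable_comp (f := fun x =>
      b i j * b u v * b s t * ((x s * x t) * ((x u * x v) * (x i * x j)))) (by fun_prop)]
    refine Finset.sum_congr rfl fun t _ => ?_
    rw [integral_const_mul, h.integral_mul_mul_mul]
  have hμ := hb.edgeMass_nonneg p
  set K := 2 * edgeMass b p + 8 * M + 16 with hK
  have hK0 : 0 ≤ K := by positivity
  have step : ∀ S : Finset (Fin n), S.card ≤ 4 →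
      ∑ s, ∑ t, b s t * p ^ (insert s (insert t S)).card ≤ p ^ S.card * K := by
    intro S hS
    refine (hb.sum_mul_pow_card_le hp hM S).trans
      (mul_le_mul_of_nonneg_left ?_ (by positivity))
    have hS' : (S.card : ℝ) ≤ 4 := by exact_mod_cast hS
    have : (0 : ℝ) ≤ S.card := by positivity
    nlinarith
  have e1 : ∀ i j u v, ∑ s, ∑ t, b i j * b u v * b s t
        * p ^ ({s, t, u, v, i, j} : Finset (Fin n)).card
      ≤ b i j * b u v * (p ^ ({u, v, i, j} : Finset (Fin n)).card * K) := by
    intro i j u v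
    simp only [mul_assoc (b i j * b u v), ← Finset.mul_sum]
    exact mul_le_mul_of_nonneg_left (step _ Finset.card_le_four)
      (mul_nonneg (hb.nonneg _ _) (hb.nonneg _ _))
  have e2 : ∀ i j, ∑ u, ∑ v, b i j * b u v * (p ^ ({u, v, i, j} : Finset (Fin n)).card * K)
      ≤ b i j * (p ^ ({i, j} : Finset (Fin n)).card * K) * K := by
    intro i j
    simp only [← mul_assoc (b i j * _), ← Finset.sum_mul]
    refine mul_le_mul_of_nonneg_right ?_ hK0
    simp only [mul_assoc (b i j), ← Finset.mul_sum]
    exact mul_le_mul_of_nonneg_left (step _ (Finset.card_le_two.trans (by norm_num)))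
      (hb.nonneg _ _)
  have e3 : ∑ i, ∑ j, b i j * (p ^ ({i, j} : Finset (Fin n)).card * K) * K ≤ K * K * K := by
    simp only [← mul_assoc, ← Finset.sum_mul]
    refine mul_le_mul_of_nonneg_right (mul_le_mul_of_nonneg_right ?_ hK0) hK0
    simpa using step ∅ (by simp)
  have e4 := (Finset.sum_le_sum fun i (_ : i ∈ Finset.univ) =>
    Finset.sum_le_sum fun j (_ : j ∈ Finset.univ) =>
    (Finset.sum_le_sum fun u (_ : u ∈ Finset.univ) =>
    Finset.sum_le_sum fun v (_ : v ∈ Finset.univ) => e1 i j u v).trans (e2 i j)).trans e3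
  rw [h1]
  have : 0 ≤ K * K * K := by positivity
  nlinarith

end IsBernoulliFamily

lemma norm_cexp_sub_cexp_le (a c : ℝ) :
    ‖Complex.exp (Complex.I * a) - Complex.exp (Complex.I * c)‖ ≤ |a - c| := by
  have h : Complex.exp (Complex.I * a) - Complex.exp (Complex.I * c)
      = Complex.exp (Complex.I * c) * (Complex.exp (Complex.I * (a - c : ℝ)) - 1) := by
    rw [mul_sub, ← Complex.exp_add]
    push_cast
    ring_nf
  rw [h, norm_mul, mul_comm Complex.I, Complex.norm_exp_ofReal_mul_I, one_mul]
  exact Real.norm_exp_I_mul_ofReal_sub_one_le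

namespace IsBernoulliFamily

lemma ae_nonneg (h : IsBernoulliFamily p X P) : ∀ᵐ ω ∂P, ∀ v, 0 ≤ X v ω := by
  filter_upwards [h.zero_or_one] with ω hω v
  rcases hω v with h0 | h0 <;> simp [h0]

/-- With `u` and `v` removed from the sum, every term involves three distinct vertices, whence `p ^
3`. This controls the other edges at `w` when `u` and `v` are chosen. -/
lemma integral_mul_mul_removed_le (h : IsBernoulliFamily p X P) (hb : IsAdjacency b) (hp : 0 ≤ p)
    (u v w : Fin n) (huv : u ≠ v) :
    ∫ ω, X u ω * X v ω
      * (∑ y, b w y * if y ∈ ({u, v} : Finset (Fin n)) then 0 else X y ω) ∂P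
      ≤ p ^ 3 * rowSum b w := by
  simp only [Finset.mul_sum]
  rw [integral_finsetSum, rowSum, Finset.mul_sum]
  · refine Finset.sum_le_sum fun y _ => ?_
    by_cases hy : y ∈ ({u, v} : Finset (Fin n))
    · simp only [hy, if_true, mul_zero, integral_zero]
      exact mul_nonneg (by positivity) (hb.nonneg _ _)
    · simp only [hy, if_false]
      have h1 := h.integral_mul_prod u v {y}
      have h2 : (insert u (insert v {y}) : Finset (Fin n)).card = 3 := by
        simp only [Finset.mem_insert, Finset.mem_singleton, not_or] at hy
        rw [Finset.card_eq_three]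
        exact ⟨u, v, y, huv, Ne.symm hy.1, Ne.symm hy.2, rfl⟩
      rw [h2] at h1
      have h3 : ∀ ω, X u ω * X v ω * (b w y * X y ω)
          = b w y * (X u ω * X v ω * ∏ z ∈ {y}, X z ω) := fun ω => by
        rw [Finset.prod_singleton]; ring
      simp only [h3]
      rw [integral_const_mul, h1, mul_comm]
  · intro y _
    by_cases hy : y ∈ ({u, v} : Finset (Fin n))
    · simp only [hy, if_true, mul_zero]
      have := h.isProbabilityMeasure
      exact integrable_const _
    · simp only [hy, if_false]
      exact h.integrable_comp (f := fun x => x u * x v * (b w y * x y)) (by fun_prop)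

lemma integral_mul_removed_le (h : IsBernoulliFamily p X P) (hb : IsAdjacency b)
    (u v w : Fin n) (hw : w ∈ ({u, v} : Finset (Fin n))) :
    ∫ ω, X w ω * (∑ y, b w y * if y ∈ ({u, v} : Finset (Fin n)) then 0 else X y ω) ∂P
      ≤ p ^ 2 * rowSum b w := by
  simp only [Finset.mul_sum]
  rw [integral_finsetSum, rowSum, Finset.mul_sum]
  · refine Finset.sum_le_sum fun y _ => ?_
    by_cases hy : y ∈ ({u, v} : Finset (Fin n))
    · simp only [hy, if_true, mul_zero, integral_zero]
      exact mul_nonneg (by positivity) (hb.nonneg _ _)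
    · simp only [hy, if_false]
      have h3 : ∀ ω, X w ω * (b w y * X y ω) = b w y * (X w ω * X y ω) := fun ω => by ring
      simp only [h3]
      rw [integral_const_mul, h.integral_mul (fun e : w = y => hy (e ▸ hw)), mul_comm]
  · intro y _
    by_cases hy : y ∈ ({u, v} : Finset (Fin n))
    · simp only [hy, if_true, mul_zero]
      have := h.isProbabilityMeasure
      exact integrable_const _
    · simp only [hy, if_false]
      exact h.integrable_comp (f := fun x => x w * (b w y * x y)) (by fun_prop)

end IsBernoulliFamily

end Moments

/-! ### Poisson approximation by a Stein-type identity for characteristic functions. -/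

section Stein

variable {n : ℕ} {Ω : Type*} [MeasurableSpace Ω] {p : ℝ} {X : Fin n → Ω → ℝ} {P : Measure Ω}
  {b : Fin n → Fin n → ℝ}

namespace IsBernoulliFamily

/-- Conditioning on the presence of an edge shifts the number of edges by one, up to the edges
meeting the given one. -/
lemma norm_integral_edge_sub_le (h : IsBernoulliFamily p X P) (hb : IsAdjacency b) (hp : 0 ≤ p)
    (hp1 : p ≤ 1) {u v : Fin n} (huv : b u v = 1) (t : ℝ) :
    ‖∫ ω, ((X u ω * X v ω : ℝ) : ℂ)
          * Complex.exp (Complex.I * (t * matrixForm b (fun w => X w ω) : ℝ)) ∂P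
        - p ^ 2 * Complex.exp (Complex.I * t)
          * ∫ ω, Complex.exp (Complex.I * (t * matrixForm b (fun w => X w ω) : ℝ)) ∂P‖
      ≤ 3 * |t| * p ^ 3 * (rowSum b u + rowSum b v) := by
  classical
  have := h.isProbabilityMeasure
  have hne : u ≠ v := fun e => by rw [e, hb.diag] at huv; norm_num at huv
  set S : Finset (Fin n) := {u, v} with hS
  set r : (Fin n → ℝ) → Fin n → ℝ := fun x w => if w ∈ S then 0 else x w with hr
  have hrc : Continuous r := continuous_pi fun w => by
    by_cases hw : w ∈ S <;> simp only [hr, hw, if_true, if_false] <;> fun_prop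
  set A : Fin n → (Fin n → ℝ) → ℝ := fun w x => ∑ y, b w y * r x y with hA
  have hAc : ∀ w, Continuous (A w) := fun w => by fun_prop
  set Y : Ω → Fin n → ℝ := fun ω w => X w ω with hY
  have hdec : ∀ x, matrixForm b x = matrixForm b (r x) + x u * A u x + x v * A v x + x u * x v := by
    intro x
    have := hb.matrixForm_eq_add hne x
    rwa [huv, one_mul] at this
  have hAnn : ∀ w, ∀ᵐ ω ∂P, 0 ≤ A w (Y ω) := by
    intro w
    filter_upwards [h.ae_nonneg] with ω hω
    refine Finset.sum_nonneg fun y _ => mul_nonneg (hb.nonneg _ _) ?_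
    simp only [hr]
    split_ifs
    exacts [le_rfl, hω y]
  have hu : u ∈ S := by simp [hS]
  have hv : v ∈ S := by simp [hS]
  -- The form without `u` and `v` is independent of `X u` and `X v`; the errors of passing to it and
  -- back are `b1` and `b2`.
  have hindep : ∫ ω, ((X u ω * X v ω : ℝ) : ℂ)
        * Complex.exp (Complex.I * (t * matrixForm b (r (Y ω)) : ℝ)) ∂P
      = p ^ 2 * ∫ ω, Complex.exp (Complex.I * (t * matrixForm b (r (Y ω)) : ℝ)) ∂P := by
    have := h.integral_prod_mul S
      (f := fun x => Complex.exp (Complex.I * (t * matrixForm b x : ℝ))) (by fun_prop)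
    rw [Finset.card_pair hne] at this
    simpa only [hS, Finset.prod_pair hne] using this
  have hi1 : Integrable (fun ω => ((X u ω * X v ω : ℝ) : ℂ)
      * Complex.exp (Complex.I * (t * matrixForm b (Y ω) : ℝ))) P :=
    h.integrable_comp (f := fun x => ((x u * x v : ℝ) : ℂ)
      * Complex.exp (Complex.I * (t * matrixForm b x : ℝ))) (by fun_prop)
  have hi2 : Integrable (fun ω => ((X u ω * X v ω : ℝ) : ℂ)
      * Complex.exp (Complex.I * (t * matrixForm b (r (Y ω)) : ℝ))) P :=
    h.integrable_comp (f := fun x => ((x u * x v : ℝ) : ℂ)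
      * Complex.exp (Complex.I * (t * matrixForm b (r x) : ℝ))) (by fun_prop)
  have hi3 : Integrable (fun ω => Complex.exp (Complex.I * (t * matrixForm b (Y ω) : ℝ))) P :=
    h.integrable_comp (f := fun x => Complex.exp (Complex.I * (t * matrixForm b x : ℝ)))
      (by fun_prop)
  have hi4 : Integrable (fun ω => Complex.exp (Complex.I * (t * matrixForm b (r (Y ω)) : ℝ))) P :=
    h.integrable_comp (f := fun x => Complex.exp (Complex.I * (t * matrixForm b (r x) : ℝ)))
      (by fun_prop)
  have hj : ∀ w, Integrable (fun ω => X u ω * X v ω * A w (Y ω)) P := fun w =>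
    h.integrable_comp (f := fun x => x u * x v * A w x) (by fun_prop)
  have hk : ∀ w, Integrable (fun ω => X w ω * A w (Y ω)) P := fun w =>
    h.integrable_comp (f := fun x => x w * A w x) (by fun_prop)
  have hl : Integrable (fun ω => X u ω * X v ω) P :=
    h.integrable_comp (f := fun x => x u * x v) (by fun_prop)
  -- Only outcomes with `X u = X v = 1` count. There the form is the reduced form plus one, for the
  -- edge itself, plus the other edges at `u` and `v`.
  have b1 : ‖∫ ω, ((X u ω * X v ω : ℝ) : ℂ)
        * Complex.exp (Complex.I * (t * matrixForm b (Y ω) : ℝ)) ∂P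
      - Complex.exp (Complex.I * t) * ∫ ω, ((X u ω * X v ω : ℝ) : ℂ)
        * Complex.exp (Complex.I * (t * matrixForm b (r (Y ω)) : ℝ)) ∂P‖
      ≤ |t| * (p ^ 3 * (rowSum b u + rowSum b v)) := by
    rw [← integral_const_mul, ← integral_sub hi1 (hi2.const_mul _)]
    have hle : ‖∫ ω, (((X u ω * X v ω : ℝ) : ℂ)
        * Complex.exp (Complex.I * (t * matrixForm b (Y ω) : ℝ))
        - Complex.exp (Complex.I * t) * (((X u ω * X v ω : ℝ) : ℂ)
        * Complex.exp (Complex.I * (t * matrixForm b (r (Y ω)) : ℝ)))) ∂P‖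
        ≤ ∫ ω, |t| * (X u ω * X v ω * A u (Y ω) + X u ω * X v ω * A v (Y ω)) ∂P := by
      refine norm_integral_le_of_norm_le (((hj u).add (hj v)).const_mul _) ?_
      filter_upwards [h.zero_or_one, hAnn u, hAnn v] with ω hω hAu hAv
      have hcomb : Complex.exp (Complex.I * t)
          * (((X u ω * X v ω : ℝ) : ℂ) * Complex.exp (Complex.I * (t * matrixForm b (r (Y ω)) : ℝ)))
          = ((X u ω * X v ω : ℝ) : ℂ)
            * Complex.exp (Complex.I * (t * (1 + matrixForm b (r (Y ω))) : ℝ)) := by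
        have : Complex.exp (Complex.I * (t * (1 + matrixForm b (r (Y ω))) : ℝ))
            = Complex.exp (Complex.I * t)
              * Complex.exp (Complex.I * (t * matrixForm b (r (Y ω)) : ℝ)) := by
          rw [← Complex.exp_add]
          push_cast
          ring_nf
        rw [this]
        ring
      rw [hcomb, ← mul_sub, norm_mul]
      rcases hω u with h0 | h0
      · simp [h0]
      rcases hω v with h1 | h1
      · simp [h1]
      have hx := hdec (Y ω)
      have hu1 : Y ω u = 1 := h0
      have hv1 : Y ω v = 1 := h1
      rw [hu1, hv1] at hx
      rw [h0, h1]
      simp only [mul_one, one_mul, Complex.ofReal_one, norm_one]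
      refine (norm_cexp_sub_cexp_le _ _).trans ?_
      rw [← mul_sub, abs_mul, hx]
      refine mul_le_mul_of_nonneg_left (le_of_eq ?_) (abs_nonneg t)
      rw [abs_of_nonneg (by linarith)]
      ring
    refine hle.trans ?_
    rw [integral_const_mul, integral_add (hj u) (hj v)]
    refine mul_le_mul_of_nonneg_left ?_ (abs_nonneg t)
    rw [mul_add]
    exact add_le_add (h.integral_mul_mul_removed_le hb hp u v u hne)
      (h.integral_mul_mul_removed_le hb hp u v v hne)
  have b2 : ‖∫ ω, Complex.exp (Complex.I * (t * matrixForm b (r (Y ω)) : ℝ)) ∂P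
      - ∫ ω, Complex.exp (Complex.I * (t * matrixForm b (Y ω) : ℝ)) ∂P‖
      ≤ |t| * (p ^ 2 * (rowSum b u + rowSum b v) + p ^ 2) := by
    rw [← integral_sub hi4 hi3]
    have hle : ‖∫ ω, (Complex.exp (Complex.I * (t * matrixForm b (r (Y ω)) : ℝ))
        - Complex.exp (Complex.I * (t * matrixForm b (Y ω) : ℝ))) ∂P‖
        ≤ ∫ ω, |t| * (X u ω * A u (Y ω) + X v ω * A v (Y ω) + X u ω * X v ω) ∂P := by
      refine norm_integral_le_of_norm_le ((((hk u).add (hk v)).add hl).const_mul _) ?_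
      filter_upwards [h.ae_nonneg, hAnn u, hAnn v] with ω hω hAu hAv
      refine (norm_cexp_sub_cexp_le _ _).trans ?_
      have h1 := mul_nonneg (hω u) hAu
      have h2 := mul_nonneg (hω v) hAv
      have h3 := mul_nonneg (hω u) (hω v)
      rw [← mul_sub, abs_mul, hdec (Y ω)]
      refine mul_le_mul_of_nonneg_left (le_of_eq ?_) (abs_nonneg t)
      rw [abs_sub_comm, abs_of_nonneg] <;> simp only [hY] at * <;> linarith
    refine hle.trans ?_
    have hadd : ∫ ω, (X u ω * A u (Y ω) + X v ω * A v (Y ω) + X u ω * X v ω) ∂P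
        = ∫ ω, X u ω * A u (Y ω) ∂P + ∫ ω, X v ω * A v (Y ω) ∂P + ∫ ω, X u ω * X v ω ∂P :=
      (integral_add ((hk u).add (hk v)) hl).trans
        (congrArg (· + _) (integral_add (hk u) (hk v)))
    rw [integral_const_mul, hadd, h.integral_mul hne]
    refine mul_le_mul_of_nonneg_left ?_ (abs_nonneg t)
    rw [mul_add]
    exact add_le_add (add_le_add (h.integral_mul_removed_le hb u v u hu)
      (h.integral_mul_removed_le hb u v v hv)) le_rfl
  rw [hindep] at b1
  -- The edge itself makes the row sum at least one. This absorbs the isolated `p ^ 2` of `b2` into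
  -- the row sums, so `b2` costs twice what `b1` does and the constant is `3 = 1 + 2`.
  have hrow : 1 ≤ rowSum b u := by
    rw [← huv]
    exact Finset.single_le_sum (fun w _ => hb.nonneg u w) (Finset.mem_univ v)
  have hrv := hb.rowSum_nonneg v
  set Φ := ∫ ω, Complex.exp (Complex.I * (t * matrixForm b (Y ω) : ℝ)) ∂P
  set Φ' := ∫ ω, Complex.exp (Complex.I * (t * matrixForm b (r (Y ω)) : ℝ)) ∂P
  set Ψ := ∫ ω, ((X u ω * X v ω : ℝ) : ℂ)
        * Complex.exp (Complex.I * (t * matrixForm b (Y ω) : ℝ)) ∂P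
  have hsplit : Ψ - p ^ 2 * Complex.exp (Complex.I * t) * Φ
      = (Ψ - Complex.exp (Complex.I * t) * (p ^ 2 * Φ'))
        + (p ^ 2 : ℝ) * (Complex.exp (Complex.I * t) * (Φ' - Φ)) := by
    push_cast
    ring
  change ‖Ψ - p ^ 2 * Complex.exp (Complex.I * t) * Φ‖ ≤ _
  rw [hsplit]
  refine (norm_add_le _ _).trans ?_
  have hn1 : ‖((p ^ 2 : ℝ) : ℂ) * (Complex.exp (Complex.I * t) * (Φ' - Φ))‖ = p ^ 2 * ‖Φ' - Φ‖ := by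
    rw [norm_mul, norm_mul, mul_comm Complex.I, Complex.norm_exp_ofReal_mul_I, one_mul,
      Complex.norm_real, Real.norm_of_nonneg (by positivity)]
  rw [hn1]
  have hp4 : p ^ 2 * p ^ 2 ≤ p ^ 3 := by
    have : p ^ 3 * p ≤ p ^ 3 * 1 := mul_le_mul_of_nonneg_left hp1 (by positivity)
    linarith [this, show p ^ 2 * p ^ 2 = p ^ 3 * p by ring]
  calc _ ≤ |t| * (p ^ 3 * (rowSum b u + rowSum b v))
        + p ^ 2 * (|t| * (p ^ 2 * (rowSum b u + rowSum b v) + p ^ 2)) :=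
        add_le_add b1 (mul_le_mul_of_nonneg_left b2 (by positivity))
    _ = |t| * (p ^ 3 * (rowSum b u + rowSum b v))
        + |t| * (p ^ 2 * p ^ 2) * (rowSum b u + rowSum b v + 1) := by ring
    _ ≤ |t| * (p ^ 3 * (rowSum b u + rowSum b v))
        + |t| * p ^ 3 * (2 * (rowSum b u + rowSum b v)) := by
        refine add_le_add le_rfl (mul_le_mul (mul_le_mul_of_nonneg_left hp4 (abs_nonneg t)) ?_ ?_ ?_)
        · linarith
        · linarith
        · positivity
    _ = _ := by ring

/-- The edge estimates are summed: `b u v * (rowSum b u + rowSum b v)` adds up to twice the sum of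
squared degrees, and the factor `1 / 2` cancels. For a Poisson variable of mean `edgeMass b p` in
place of the form the difference would vanish. -/
lemma norm_integral_matrixForm_mul_sub_le (h : IsBernoulliFamily p X P) (hb : IsAdjacency b)
    (hp : 0 ≤ p) (hp1 : p ≤ 1) (t : ℝ) :
    ‖∫ ω, ((matrixForm b (fun w => X w ω) : ℝ) : ℂ)
          * Complex.exp (Complex.I * (t * matrixForm b (fun w => X w ω) : ℝ)) ∂P
        - edgeMass b p * Complex.exp (Complex.I * t)
          * ∫ ω, Complex.exp (Complex.I * (t * matrixForm b (fun w => X w ω) : ℝ)) ∂P‖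
      ≤ 3 * |t| * pathMass b p := by
  set e : Ω → ℂ := fun ω => Complex.exp (Complex.I * (t * matrixForm b (fun w => X w ω) : ℝ))
    with he
  have h1 : ∫ ω, ((matrixForm b (fun w => X w ω) : ℝ) : ℂ) * e ω ∂P
      = 1 / 2 * ∑ u, ∑ v, (b u v : ℂ) * ∫ ω, ((X u ω * X v ω : ℝ) : ℂ) * e ω ∂P := by
    have h2 : ∀ ω, ((matrixForm b (fun w => X w ω) : ℝ) : ℂ) * e ω
        = 1 / 2 * ∑ u, ∑ v, (b u v : ℂ) * (((X u ω * X v ω : ℝ) : ℂ) * e ω) := by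
      intro ω
      rw [matrixForm]
      push_cast
      simp only [Finset.mul_sum, Finset.sum_mul]
      exact Finset.sum_congr rfl fun u _ => Finset.sum_congr rfl fun v _ => by ring
    simp only [h2]
    rw [integral_const_mul]
    congr 1
    rw [integral_finsetSum _ fun u _ => h.integrable_comp (f := fun x => ∑ v, (b u v : ℂ)
      * (((x u * x v : ℝ) : ℂ) * Complex.exp (Complex.I * (t * matrixForm b x : ℝ))))
      (by fun_prop)]
    refine Finset.sum_congr rfl fun u _ => ?_
    rw [integral_finsetSum _ fun v _ => h.integrable_comp (f := fun x => (b u v : ℂ)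
      * (((x u * x v : ℝ) : ℂ) * Complex.exp (Complex.I * (t * matrixForm b x : ℝ))))
      (by fun_prop)]
    exact Finset.sum_congr rfl fun v _ => integral_const_mul _ _
  rw [h1]
  have h3 : (1 / 2 * ∑ u, ∑ v, (b u v : ℂ) * ∫ ω, ((X u ω * X v ω : ℝ) : ℂ) * e ω ∂P)
      - edgeMass b p * Complex.exp (Complex.I * t) * ∫ ω, e ω ∂P
      = 1 / 2 * ∑ u, ∑ v, (b u v : ℂ) * (∫ ω, ((X u ω * X v ω : ℝ) : ℂ) * e ω ∂P
        - p ^ 2 * Complex.exp (Complex.I * t) * ∫ ω, e ω ∂P) := by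
    simp only [mul_sub, Finset.sum_sub_distrib, edgeMass]
    push_cast
    simp only [Finset.mul_sum, Finset.sum_mul]
    congr 1
    exact Finset.sum_congr rfl fun u _ => Finset.sum_congr rfl fun v _ => by ring
  rw [h3, norm_mul]
  have h4 : ∀ u v, ‖(b u v : ℂ) * (∫ ω, ((X u ω * X v ω : ℝ) : ℂ) * e ω ∂P
        - p ^ 2 * Complex.exp (Complex.I * t) * ∫ ω, e ω ∂P)‖
      ≤ 3 * |t| * p ^ 3 * (b u v * rowSum b u + b u v * rowSum b v) := by
    intro u v
    rcases hb.zero_or_one u v with h0 | h0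
    · simp [h0]
    · rw [h0, Complex.ofReal_one, one_mul, one_mul, one_mul]
      exact h.norm_integral_edge_sub_le hb hp hp1 h0 t
  have h5 : ‖∑ u, ∑ v, (b u v : ℂ) * (∫ ω, ((X u ω * X v ω : ℝ) : ℂ) * e ω ∂P
        - p ^ 2 * Complex.exp (Complex.I * t) * ∫ ω, e ω ∂P)‖
      ≤ ∑ u, ∑ v, 3 * |t| * p ^ 3 * (b u v * rowSum b u + b u v * rowSum b v) :=
    norm_sum_le_of_le _ fun u _ => norm_sum_le_of_le _ fun v _ => h4 u v
  simp only [← Finset.mul_sum, Finset.sum_add_distrib] at h5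
  rw [sum_mul_rowSum, hb.sum_mul_rowSum_right] at h5
  have h6 : ‖(1 / 2 : ℂ)‖ = 1 / 2 := by simp
  rw [h6, pathMass]
  linarith

/-- Poisson approximation of the characteristic function of the number of spanned edges. -/
lemma norm_integral_cexp_sub_le (h : IsBernoulliFamily p X P) (hb : IsAdjacency b)
    (hp : 0 ≤ p) (hp1 : p ≤ 1) (t : ℝ) :
    ‖∫ ω, Complex.exp (Complex.I * (t * matrixForm b (fun w => X w ω) : ℝ)) ∂P
        - Complex.exp (edgeMass b p * (Complex.exp (Complex.I * t) - 1))‖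
      ≤ 3 * t ^ 2 * pathMass b p * Real.exp (2 * edgeMass b p) := by
  have hP := h.isProbabilityMeasure
  set T : Ω → ℝ := fun ω => matrixForm b (fun w => X w ω) with hT
  set μ := edgeMass b p with hμ
  have hμ0 : 0 ≤ μ := hb.edgeMass_nonneg p
  set φ : ℝ → ℂ := fun s => ∫ ω, Complex.exp (Complex.I * (s * T ω : ℝ)) ∂P with hφ
  have hTi : Integrable T P := h.integrable_comp (continuous_matrixForm b)
  have hφd : ∀ s, HasDerivAt φ (∫ ω, Complex.exp (Complex.I * (s * T ω : ℝ))
      * (Complex.I * T ω) ∂P) s := by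
    intro s
    refine (hasDerivAt_integral_of_dominated_loc_of_deriv_le (bound := fun ω => |T ω|)
      (F := fun s ω => Complex.exp (Complex.I * (s * T ω : ℝ)))
      (F' := fun s ω => Complex.exp (Complex.I * (s * T ω : ℝ)) * (Complex.I * T ω))
      (Filter.univ_mem) ?_ ?_ ?_ ?_ hTi.abs ?_).2
    · refine Eventually.of_forall fun s => (h.integrable_comp (f := fun x =>
        Complex.exp (Complex.I * (s * matrixForm b x : ℝ))) (by fun_prop)).aestronglyMeasurable
    · exact h.integrable_comp (f := fun x =>
        Complex.exp (Complex.I * (s * matrixForm b x : ℝ))) (by fun_prop)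
    · exact (h.integrable_comp (f := fun x => Complex.exp (Complex.I * (s * matrixForm b x : ℝ))
        * (Complex.I * matrixForm b x)) (by fun_prop)).aestronglyMeasurable
    · refine Eventually.of_forall fun ω s _ => le_of_eq ?_
      rw [norm_mul, norm_mul, mul_comm Complex.I, Complex.norm_exp_ofReal_mul_I]
      simp
    · refine Eventually.of_forall fun ω s _ => ?_
      have h1 : HasDerivAt (fun s : ℝ => Complex.I * ((s * T ω : ℝ) : ℂ)) (Complex.I * T ω) s := by
        have := (((hasDerivAt_id s).mul_const (T ω)).ofReal_comp).const_mul Complex.I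
        simpa using this
      exact h1.cexp
  -- Integrating factor of `φ' = i μ exp(is) φ`: `ψ` would be constant if `φ` were the Poisson
  -- characteristic function.
  set ψ : ℝ → ℂ := fun s => φ s * Complex.exp (-(μ * Complex.exp (Complex.I * s))) with hψ
  have hexp : ∀ s : ℝ, HasDerivAt (fun s : ℝ => Complex.exp (Complex.I * s))
      (Complex.exp (Complex.I * s) * Complex.I) s := by
    intro s
    have h1 : HasDerivAt (fun s : ℝ => Complex.I * (s : ℂ)) Complex.I s := by
      simpa using (hasDerivAt_id s).ofReal_comp.const_mul Complex.I
    exact h1.cexp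
  have hψd : ∀ s, HasDerivAt ψ (Complex.I * (∫ ω, ((T ω : ℝ) : ℂ)
      * Complex.exp (Complex.I * (s * T ω : ℝ)) ∂P - μ * Complex.exp (Complex.I * s) * φ s)
      * Complex.exp (-(μ * Complex.exp (Complex.I * s)))) s := by
    intro s
    have h1 := (hφd s).mul (((hexp s).const_mul (μ : ℂ)).neg.cexp)
    refine h1.congr_deriv ?_
    have h2 : ∫ ω, Complex.exp (Complex.I * (s * T ω : ℝ)) * (Complex.I * T ω) ∂P
        = Complex.I * ∫ ω, ((T ω : ℝ) : ℂ) * Complex.exp (Complex.I * (s * T ω : ℝ)) ∂P := by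
      rw [← integral_const_mul]
      exact integral_congr_ae (Eventually.of_forall fun ω => by ring)
    rw [h2]
    simp only [Pi.neg_apply]
    ring
  have hnexp : ∀ s : ℝ, ‖(μ : ℂ) * Complex.exp (Complex.I * s)‖ = μ := by
    intro s
    rw [norm_mul, mul_comm Complex.I, Complex.norm_exp_ofReal_mul_I, mul_one, Complex.norm_real,
      Real.norm_of_nonneg hμ0]
  have hbound : ∀ s ∈ Set.uIcc 0 t, ‖Complex.I * (∫ ω, ((T ω : ℝ) : ℂ)
      * Complex.exp (Complex.I * (s * T ω : ℝ)) ∂P - μ * Complex.exp (Complex.I * s) * φ s)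
      * Complex.exp (-(μ * Complex.exp (Complex.I * s)))‖
      ≤ 3 * |t| * pathMass b p * Real.exp μ := by
    intro s hs
    have hst : |s| ≤ |t| := by
      have := Set.abs_sub_left_of_mem_uIcc hs
      simpa using this
    rw [norm_mul, norm_mul, Complex.norm_I, one_mul]
    refine mul_le_mul ?_ ?_ (norm_nonneg _) ?_
    · refine (h.norm_integral_matrixForm_mul_sub_le hb hp hp1 s).trans ?_
      have := IsAdjacency.pathMass_nonneg (b := b) hp
      gcongr
    · refine (Complex.norm_exp_le_exp_norm _).trans ?_
      rw [norm_neg, hnexp]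
    · have := IsAdjacency.pathMass_nonneg (b := b) hp
      positivity
  have hmv := (convex_uIcc 0 t).norm_image_sub_le_of_norm_hasDerivWithin_le
    (fun s _ => (hψd s).hasDerivWithinAt) hbound Set.left_mem_uIcc Set.right_mem_uIcc
  have hψ0 : ψ 0 = Complex.exp (-μ) := by
    simp [hψ, hφ]
  have hfin : φ t - Complex.exp (μ * (Complex.exp (Complex.I * t) - 1))
      = (ψ t - ψ 0) * Complex.exp (μ * Complex.exp (Complex.I * t)) := by
    rw [hψ0, sub_mul, ← Complex.exp_add]
    simp only [hψ]
    rw [mul_assoc, ← Complex.exp_add]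
    simp only [neg_add_cancel, Complex.exp_zero, mul_one]
    ring_nf
  change ‖φ t - _‖ ≤ _
  rw [hfin, norm_mul]
  -- One factor `exp μ` bounds the integrating factor, the other comes from undoing it; the second
  -- `|t|` is the length of the interval.
  calc _ ≤ (3 * |t| * pathMass b p * Real.exp μ * ‖t - 0‖) * Real.exp μ := by
        refine mul_le_mul hmv ?_ (norm_nonneg _) ((norm_nonneg _).trans hmv)
        refine (Complex.norm_exp_le_exp_norm _).trans ?_
        rw [hnexp]
    _ = 3 * (|t| * |t|) * pathMass b p * (Real.exp μ * Real.exp μ) := by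
        rw [sub_zero, Real.norm_eq_abs]; ring
    _ = _ := by
        rw [abs_mul_abs_self, ← Real.exp_add]
        ring_nf

end IsBernoulliFamily

end Stein

/-! ### Double limits in terms of `ε`. -/

/-- The iterated lower limit never exceeds the iterated upper limit, so it suffices to bound the
former below and the latter above by `l`. The threshold for `n` may depend on `M`. -/
lemma doubleLimit_iff {a : ℝ → ℕ → ℝ} {l : ℝ} : DoubleLimit a l ↔
    ∀ ε > 0, ∀ᶠ M in atTop, ∀ᶠ n in atTop, |a M n - l| < ε := by
  constructor
  · rintro ⟨h1, h2⟩ ε hε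
    have e1 : ∀ᶠ M in atTop, limsup (fun n : ℕ => (a M n : EReal)) atTop < ((l + ε : ℝ) : EReal) :=
      eventually_lt_of_limsup_lt (by rw [h1]; exact_mod_cast (by linarith : l < l + ε))
    have e2 : ∀ᶠ M in atTop, ((l - ε : ℝ) : EReal) < liminf (fun n : ℕ => (a M n : EReal)) atTop :=
      eventually_lt_of_lt_liminf (by rw [h2]; exact_mod_cast (by linarith : l - ε < l))
    filter_upwards [e1, e2] with M hM1 hM2
    filter_upwards [eventually_lt_of_limsup_lt hM1, eventually_lt_of_lt_liminf hM2] with n hn1 hn2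
    have hn1' : a M n < l + ε := by exact_mod_cast hn1
    have hn2' : l - ε < a M n := by exact_mod_cast hn2
    rw [abs_lt]
    constructor <;> linarith
  · intro h
    have hle : limsup (fun M : ℝ => limsup (fun n : ℕ => (a M n : EReal)) atTop) atTop
        ≤ (l : EReal) := by
      rw [← EReal.le_of_forall_lt_iff_le]
      intro z hz
      have hz' : l < z := by exact_mod_cast hz
      refine limsup_le_of_le (h := ?_)
      filter_upwards [h (z - l) (by linarith)] with M hM
      refine limsup_le_of_le (h := ?_)
      filter_upwards [hM] with n hn
      have := (abs_lt.1 hn).2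
      exact_mod_cast (by linarith : a M n ≤ z)
    have hge : (l : EReal)
        ≤ liminf (fun M : ℝ => liminf (fun n : ℕ => (a M n : EReal)) atTop) atTop := by
      rw [← EReal.ge_of_forall_gt_iff_ge]
      intro z hz
      have hz' : z < l := by exact_mod_cast hz
      refine le_liminf_of_le (h := ?_)
      filter_upwards [h (l - z) (by linarith)] with M hM
      refine le_liminf_of_le (h := ?_)
      filter_upwards [hM] with n hn
      have := (abs_lt.1 hn).1
      exact_mod_cast (by linarith : z ≤ a M n)
    have hmid : liminf (fun M : ℝ => liminf (fun n : ℕ => (a M n : EReal)) atTop) atTop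
        ≤ limsup (fun M : ℝ => limsup (fun n : ℕ => (a M n : EReal)) atTop) atTop :=
      (liminf_le_liminf (Eventually.of_forall fun M => liminf_le_limsup)).trans liminf_le_limsup
    exact ⟨le_antisymm hle (hge.trans hmid), le_antisymm (hmid.trans hle) hge⟩

/-! ### Truncation at large degrees. -/

/-- The indicator of the vertices of degree at most `M r`. -/
def lowDeg {n : ℕ} (G : SimpleGraph (Fin n)) (r M : ℝ) (u : Fin n) : ℝ :=
  truncVec G r M (fun _ => 1) u

/-- The adjacency matrix of the graph spanned by the vertices of degree at most `M r`. -/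
def truncAdj {n : ℕ} (G : SimpleGraph (Fin n)) (r M : ℝ) (u v : Fin n) : ℝ :=
  adj G u v * lowDeg G r M u * lowDeg G r M v

section Graph

variable {n : ℕ} (G : SimpleGraph (Fin n)) (r M : ℝ)

lemma lowDeg_of_le {u : Fin n} (h : (deg G u : ℝ) ≤ M * r) : lowDeg G r M u = 1 := by
  simp [lowDeg, truncVec, h]

lemma lowDeg_of_lt {u : Fin n} (h : M * r < deg G u) : lowDeg G r M u = 0 := by
  simp [lowDeg, truncVec, h]

lemma lowDeg_nonneg (u : Fin n) : 0 ≤ lowDeg G r M u := by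
  rcases le_or_gt (deg G u : ℝ) (M * r) with h | h
  · simp [lowDeg_of_le G r M h]
  · simp [lowDeg_of_lt G r M h]

lemma lowDeg_le_one (u : Fin n) : lowDeg G r M u ≤ 1 := by
  rcases le_or_gt (deg G u : ℝ) (M * r) with h | h
  · simp [lowDeg_of_le G r M h]
  · simp [lowDeg_of_lt G r M h]

lemma lowDeg_mono {r : ℝ} (hr : 0 ≤ r) {M M' : ℝ} (h : M ≤ M') (u : Fin n) :
    lowDeg G r M u ≤ lowDeg G r M' u := by
  rcases le_or_gt (deg G u : ℝ) (M * r) with h1 | h1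
  · rw [lowDeg_of_le G r M h1,
      lowDeg_of_le G r M' (h1.trans (mul_le_mul_of_nonneg_right h hr))]
  · rw [lowDeg_of_lt G r M h1]
    exact lowDeg_nonneg G r M' u

lemma truncVec_eq (x : Fin n → ℝ) (u : Fin n) : truncVec G r M x u = lowDeg G r M u * x u := by
  simp [lowDeg, truncVec]

lemma quadForm_eq (x : Fin n → ℝ) : quadForm G x = matrixForm (adj G) x := rfl

/-- Truncating the variables amounts to deleting the edges at high-degree vertices, so all results
on `matrixForm` apply to the truncated form. -/
lemma truncQuadForm_eq (x : Fin n → ℝ) :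
    truncQuadForm G r M x = matrixForm (truncAdj G r M) x := by
  simp only [truncQuadForm, quadForm, matrixForm, truncVec_eq, truncAdj]
  congr 1
  exact Finset.sum_congr rfl fun u _ => Finset.sum_congr rfl fun v _ => by ring

lemma isAdjacency_adj : IsAdjacency (adj G) where
  symm u v := by
    by_cases h : G.Adj u v
    · simp [adj, h, h.symm]
    · have h' : ¬ G.Adj v u := fun h' => h h'.symm
      simp [adj, h, h']
  diag u := by simp [adj]
  zero_or_one u v := by
    unfold adj
    split_ifs <;> simp

lemma isAdjacency_truncAdj : IsAdjacency (truncAdj G r M) where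
  symm u v := by rw [truncAdj, truncAdj, (isAdjacency_adj G).symm]; ring
  diag u := by simp [truncAdj, (isAdjacency_adj G).diag]
  zero_or_one u v := by
    have h : ∀ w, lowDeg G r M w = 0 ∨ lowDeg G r M w = 1 := fun w => by
      rcases le_or_gt (deg G w : ℝ) (M * r) with h | h
      · exact .inr (lowDeg_of_le G r M h)
      · exact .inl (lowDeg_of_lt G r M h)
    rcases (isAdjacency_adj G).zero_or_one u v with h1 | h1 <;> rcases h u with h2 | h2 <;>
      rcases h v with h3 | h3 <;> simp [truncAdj, h1, h2, h3]

lemma truncAdj_le_adj (u v : Fin n) : truncAdj G r M u v ≤ adj G u v := by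
  have h := (isAdjacency_adj G).nonneg u v
  exact (mul_le_of_le_one_right (mul_nonneg h (lowDeg_nonneg _ _ _ _)) (lowDeg_le_one _ _ _ _)).trans
    (mul_le_of_le_one_right h (lowDeg_le_one _ _ _ _))

lemma truncAdj_mono {r : ℝ} (hr : 0 ≤ r) {M M' : ℝ} (h : M ≤ M') (u v : Fin n) :
    truncAdj G r M u v ≤ truncAdj G r M' u v := by
  have h0 := (isAdjacency_adj G).nonneg u v
  have h1 := lowDeg_mono G hr h u
  have h2 := lowDeg_mono G hr h v
  have h3 := lowDeg_nonneg G r M u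
  have h4 := lowDeg_nonneg G r M v
  have h5 := lowDeg_nonneg G r M' u
  unfold truncAdj
  gcongr

lemma rowSum_adj (u : Fin n) : rowSum (adj G) u = deg G u := by
  classical
  have h : {v | G.Adj u v} = ((Finset.univ.filter (G.Adj u) : Finset (Fin n)) : Set (Fin n)) := by
    ext; simp
  rw [deg, SimpleGraph.neighborSet, h, Set.ncard_coe_finset, Finset.card_filter]
  push_cast
  exact Finset.sum_congr rfl fun v _ => by simp [adj]

lemma rowSum_truncAdj_le (u : Fin n) :
    rowSum (truncAdj G r M) u ≤ deg G u * lowDeg G r M u := by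
  rw [← rowSum_adj, rowSum, rowSum, Finset.sum_mul]
  refine Finset.sum_le_sum fun v _ => ?_
  exact mul_le_of_le_one_right (mul_nonneg ((isAdjacency_adj G).nonneg u v)
    (lowDeg_nonneg _ _ _ _)) (lowDeg_le_one _ _ _ _)

lemma deg_mul_lowDeg_le (hMr : 0 ≤ M * r) (u : Fin n) : deg G u * lowDeg G r M u ≤ M * r := by
  rcases le_or_gt (deg G u : ℝ) (M * r) with h | h
  · simpa [lowDeg_of_le G r M h] using h
  · simpa [lowDeg_of_lt G r M h] using hMr

lemma sum_deg_eq : ∑ u, (deg G u : ℝ) = 2 * (G.edgeSet.ncard : ℝ) := by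
  classical
  have h := G.sum_degrees_eq_twice_card_edges
  have h1 : ∀ u, deg G u = G.degree u := fun u => by
    rw [deg, Set.ncard_eq_toFinset_card', ← G.card_neighborFinset_eq_degree]; rfl
  have h2 : G.edgeSet.ncard = G.edgeFinset.card := by
    rw [Set.ncard_eq_toFinset_card']; rfl
  rw [h2]
  simp only [h1]
  exact_mod_cast h

lemma sum_deg_mul_sq (p : ℝ) : ∑ u, (deg G u : ℝ) * p ^ 2 = 2 * edgeMass (adj G) p := by
  simp only [edgeMass, ← Finset.sum_mul]
  simp only [← rowSum_adj, rowSum]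
  ring

lemma edgeMass_adj (p : ℝ) : edgeMass (adj G) p = (G.edgeSet.ncard : ℝ) * p ^ 2 := by
  have h := sum_deg_mul_sq G p
  rw [← Finset.sum_mul, sum_deg_eq] at h
  linarith

lemma edgeMass_truncAdj_le (p : ℝ) : edgeMass (truncAdj G r M) p ≤ edgeMass (adj G) p :=
  mul_le_mul_of_nonneg_left (Finset.sum_le_sum fun u _ => Finset.sum_le_sum fun v _ =>
    mul_le_mul_of_nonneg_right (truncAdj_le_adj G r M u v) (sq_nonneg p)) (by norm_num)

lemma pathMass_truncAdj_mono {r : ℝ} (hr : 0 ≤ r) {M M' : ℝ} (h : M ≤ M') {p : ℝ} (hp : 0 ≤ p) :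
    pathMass (truncAdj G r M) p ≤ pathMass (truncAdj G r M') p := by
  refine mul_le_mul_of_nonneg_left (Finset.sum_le_sum fun u _ => ?_) (by positivity)
  exact pow_le_pow_left₀ ((isAdjacency_truncAdj G r M).rowSum_nonneg u)
    (Finset.sum_le_sum fun v _ => truncAdj_mono G hr h u v) 2

/-- The expected number of chosen vertices of degree larger than `M / p`. -/
lemma mul_sum_one_sub_lowDeg_le {p : ℝ} (hp : 0 < p) :
    M * ∑ u, p * (1 - lowDeg G (1 / p) M u) ≤ 2 * edgeMass (adj G) p := by
  rw [← sum_deg_mul_sq, Finset.mul_sum]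
  refine Finset.sum_le_sum fun u _ => ?_
  -- Markov's inequality, vertex by vertex.
  rcases le_or_gt (deg G u : ℝ) (M * (1 / p)) with h | h
  · rw [lowDeg_of_le G _ M h]
    simp only [sub_self, mul_zero]
    positivity
  · rw [lowDeg_of_lt G _ M h]
    have h1 : M < deg G u * p := by
      rw [mul_one_div, div_lt_iff₀ hp] at h
      exact h
    nlinarith

end Graph

section Truncation

variable {n : ℕ} {Ω : Type*} [MeasurableSpace Ω] {p : ℝ} {X : Fin n → Ω → ℝ} {P : Measure Ω}

/-- The truncation changes the law of the quadratic form only slightly. -/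
lemma IsBernoulliFamily.norm_integral_sub_truncated_le {E : Type*} [NormedAddCommGroup E]
    [NormedSpace ℝ E] [SecondCountableTopology E] (h : IsBernoulliFamily p X P) (hp : 0 < p)
    (G : SimpleGraph (Fin n)) {M : ℝ} (hM : 0 < M) {g : ℝ → E} (hg : Continuous g) {B : ℝ}
    (hB : ∀ x, ‖g x‖ ≤ B) :
    ‖∫ ω, g (matrixForm (adj G) (fun v => X v ω)) ∂P
      - ∫ ω, g (matrixForm (truncAdj G (1 / p) M) (fun v => X v ω)) ∂P‖
      ≤ 4 * B * edgeMass (adj G) p / M := by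
  have hB0 : 0 ≤ B := (norm_nonneg _).trans (hB 0)
  have hi1 : Integrable (fun ω => g (matrixForm (adj G) (fun v => X v ω))) P :=
    h.integrable_comp (f := fun x => g (matrixForm (adj G) x)) (by fun_prop)
  have hi2 : Integrable (fun ω => g (matrixForm (truncAdj G (1 / p) M) (fun v => X v ω))) P :=
    h.integrable_comp (f := fun x => g (matrixForm (truncAdj G (1 / p) M) x)) (by fun_prop)
  have hi3 : Integrable (fun ω => 2 * B * ∑ u, X u ω * (1 - lowDeg G (1 / p) M u)) P :=
    h.integrable_comp (f := fun x => 2 * B * ∑ u, x u * (1 - lowDeg G (1 / p) M u)) (by fun_prop)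
  rw [← integral_sub hi1 hi2]
  have hle : ∀ᵐ ω ∂P, ‖g (matrixForm (adj G) (fun v => X v ω))
      - g (matrixForm (truncAdj G (1 / p) M) (fun v => X v ω))‖
      ≤ 2 * B * ∑ u, X u ω * (1 - lowDeg G (1 / p) M u) := by
    filter_upwards [h.zero_or_one] with ω hω
    have hnn : ∀ u ∈ Finset.univ, 0 ≤ X u ω * (1 - lowDeg G (1 / p) M u) := fun u _ => by
      refine mul_nonneg ?_ (sub_nonneg.2 (lowDeg_le_one _ _ _ _))
      rcases hω u with h0 | h0 <;> simp [h0]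
    -- Either no high-degree vertex is chosen and both forms agree, or the sum on the right is at
    -- least one and the trivial bound `2 * B` suffices.
    by_cases hall : ∀ u, X u ω * (1 - lowDeg G (1 / p) M u) = 0
    · have heq : matrixForm (truncAdj G (1 / p) M) (fun v => X v ω)
          = matrixForm (adj G) (fun v => X v ω) := by
        rw [← truncQuadForm_eq, truncQuadForm, quadForm_eq]
        congr 1
        ext u
        rw [truncVec_eq]
        linarith [hall u]
      rw [heq, sub_self, norm_zero]
      exact mul_nonneg (by positivity) (Finset.sum_nonneg hnn)
    · push Not at hall
      obtain ⟨u, hu⟩ := hall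
      have h1 : X u ω * (1 - lowDeg G (1 / p) M u) = 1 := by
        rcases hω u with h0 | h0
        · simp [h0] at hu
        rcases le_or_gt (deg G u : ℝ) (M * (1 / p)) with h2 | h2
        · exact absurd (by rw [lowDeg_of_le G _ M h2, sub_self, mul_zero]) hu
        · rw [h0, lowDeg_of_lt G _ M h2]
          norm_num
      have h2 := Finset.single_le_sum hnn (Finset.mem_univ u)
      rw [h1] at h2
      calc _ ≤ B + B := (norm_sub_le _ _).trans (add_le_add (hB _) (hB _))
        _ = 2 * B * 1 := by ring
        _ ≤ _ := mul_le_mul_of_nonneg_left h2 (by positivity)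
  refine (norm_integral_le_of_norm_le hi3 hle).trans ?_
  have hval : ∫ ω, 2 * B * ∑ u, X u ω * (1 - lowDeg G (1 / p) M u) ∂P
      = 2 * B * ∑ u, p * (1 - lowDeg G (1 / p) M u) := by
    rw [integral_const_mul, integral_finsetSum _ fun u _ => h.integrable_comp
      (f := fun x => x u * (1 - lowDeg G (1 / p) M u)) (by fun_prop)]
    simp only [integral_mul_const, h.integral_eq]
  rw [hval, le_div_iff₀ hM]
  have := mul_sum_one_sub_lowDeg_le G M hp
  nlinarith

end Truncation

/-! ### Moments and truncated moments of the Poisson law. -/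

section PoissonMoments

lemma hasSum_poisson_one (r : ℝ≥0) :
    HasSum (fun k : ℕ => Real.exp (-r) * r ^ k / (k.factorial : ℝ) * (k : ℝ)) r := by
  rw [← hasSum_nat_add_iff' 1]
  have h := (hasSum_one_poissonMeasure r).mul_left (r : ℝ)
  simp only [Finset.range_one, Finset.sum_singleton, Nat.cast_zero, mul_zero, sub_zero]
  rw [mul_one] at h
  refine h.congr_fun fun k => ?_
  rw [Nat.factorial_succ]
  push_cast
  field_simp
  ring

lemma hasSum_poisson_two (r : ℝ≥0) :
    HasSum (fun k : ℕ => Real.exp (-r) * r ^ k / (k.factorial : ℝ) * (k : ℝ) ^ 2)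
      ((r : ℝ) ^ 2 + r) := by
  rw [← hasSum_nat_add_iff' 1]
  have h := ((hasSum_poisson_one r).add (hasSum_one_poissonMeasure r)).mul_left (r : ℝ)
  simp only [Finset.range_one, Finset.sum_singleton, Nat.cast_zero, ne_eq, OfNat.ofNat_ne_zero,
    not_false_eq_true, zero_pow, mul_zero, sub_zero]
  rw [show (r : ℝ) * (r + 1) = (r : ℝ) ^ 2 + r by ring] at h
  refine h.congr_fun fun k => ?_
  rw [Nat.factorial_succ]
  push_cast
  field_simp
  ring

lemma integrable_poisson_one (r : ℝ≥0) :
    Integrable (fun k : ℕ => (k : ℝ) ^ 1) (poissonMeasure r) := by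
  rw [integrable_poissonMeasure_iff]
  simpa using (hasSum_poisson_one r).summable

lemma integrable_poisson_two (r : ℝ≥0) :
    Integrable (fun k : ℕ => (k : ℝ) ^ 2) (poissonMeasure r) := by
  rw [integrable_poissonMeasure_iff]
  simpa using (hasSum_poisson_two r).summable

lemma integral_poisson_one (r : ℝ≥0) : ∫ k : ℕ, (k : ℝ) ^ 1 ∂(poissonMeasure r) = r := by
  rw [integral_poissonMeasure]
  simpa using (hasSum_poisson_one r).tsum_eq

lemma integral_poisson_two (r : ℝ≥0) :
    ∫ k : ℕ, (k : ℝ) ^ 2 ∂(poissonMeasure r) = (r : ℝ) ^ 2 + r := by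
  rw [integral_poissonMeasure]
  simpa using (hasSum_poisson_two r).tsum_eq

lemma tendsto_integral_poisson_min (r : ℝ≥0) {k : ℕ}
    (hi : Integrable (fun j : ℕ => (j : ℝ) ^ k) (poissonMeasure r)) :
    Tendsto (fun L : ℝ => ∫ j : ℕ, min (|(j : ℝ)| ^ k) (L ^ k) ∂(poissonMeasure r)) atTop
      (𝓝 (∫ j : ℕ, (j : ℝ) ^ k ∂(poissonMeasure r))) := by
  refine tendsto_integral_filter_of_dominated_convergence (fun j : ℕ => (j : ℝ) ^ k)
    (Eventually.of_forall fun L => Measurable.aestronglyMeasurable (by fun_prop)) ?_ hi ?_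
  · filter_upwards [eventually_ge_atTop 0] with L hL
    refine Eventually.of_forall fun j => ?_
    rw [Real.norm_of_nonneg (by positivity), Nat.abs_cast]
    exact min_le_left _ _
  · refine Eventually.of_forall fun j => tendsto_const_nhds.congr' ?_
    filter_upwards [eventually_ge_atTop (j : ℝ)] with L hL
    rw [Nat.abs_cast, min_eq_left (pow_le_pow_left₀ (by positivity) hL k)]

end PoissonMoments

/-! ### From truncated quantities to the Poisson limit, and back. -/

section Sequences

variable {G : (n : ℕ) → SimpleGraph (Fin n)} {p : ℕ → ℝ} {Ω : ℕ → Type*}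
  [∀ n, MeasurableSpace (Ω n)] {P : (n : ℕ) → Measure (Ω n)} [∀ n, IsProbabilityMeasure (P n)]
  {X : (n : ℕ) → Fin n → Ω n → ℝ} {C : ℝ} {lam : ℝ≥0}

/-- Poisson convergence when the truncated paths disappear and the truncated means converge. -/
theorem tendstoInDistribution_of_tendsto_pathMass (hfam : ∀ n, IsBernoulliFamily (p n) (X n) (P n))
    (hp0 : ∀ n, 0 < p n) (hp1 : ∀ n, p n ≤ 1)
    (hC : ∀ᶠ n in atTop, edgeMass (adj (G n)) (p n) ≤ C)
    (hS : ∀ M > 0,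
      Tendsto (fun n => pathMass (truncAdj (G n) (1 / p n) M) (p n)) atTop (𝓝 0))
    (hE : ∀ ε > 0, ∀ᶠ M in atTop, ∀ᶠ n in atTop,
      |edgeMass (truncAdj (G n) (1 / p n) M) (p n) - lam| < ε) :
    TendstoInDistribution (fun n ω => quadForm (G n) (fun v => X n v ω)) atTop
      (fun k : ℕ => (k : ℝ)) P (poissonMeasure lam) := by
  have hmeas : ∀ n, AEMeasurable (fun ω => quadForm (G n) (fun v => X n v ω)) (P n) := fun n =>
    ((hfam n).integrable_comp (continuous_matrixForm (adj (G n)))).aemeasurable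
  refine ⟨hmeas, Measurable.aemeasurable (by fun_prop), ?_⟩
  refine ProbabilityMeasure.tendsto_iff_tendsto_charFun.2 fun t => ?_
  simp only [ProbabilityMeasure.coe_mk]
  rw [charFun_map_cast_poissonMeasure]
  have hcf : ∀ n, charFun ((P n).map (fun ω => quadForm (G n) (fun v => X n v ω))) t
      = ∫ ω, Complex.exp (Complex.I * (t * matrixForm (adj (G n)) (fun v => X n v ω) : ℝ))
        ∂(P n) := by
    intro n
    rw [charFun_apply_real, integral_map (hmeas n) (by fun_prop)]
    refine integral_congr_ae (Eventually.of_forall fun ω => ?_)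
    simp only [quadForm_eq]
    push_cast
    ring_nf
  simp only [hcf]
  rw [show (Complex.exp (t * Complex.I)) = Complex.exp (Complex.I * t) by rw [mul_comm]]
  rw [Metric.tendsto_nhds]
  intro ε hε
  have hcont : Continuous fun m : ℝ => Complex.exp ((m : ℂ) * (Complex.exp (Complex.I * t) - 1)) := by
    fun_prop
  obtain ⟨δ, hδ, hδε⟩ := Metric.continuous_iff.1 hcont lam (ε / 3) (by positivity)
  have hMl : ∀ᶠ M : ℝ in atTop, 4 * 1 * C / M < ε / 3 :=
    (tendsto_const_nhds.div_atTop tendsto_id).eventually_lt_const (by positivity)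
  -- One fixed `M` makes both the truncation error and the error in the mean small; then `n → ∞`
  -- removes the `pathMass` error.
  obtain ⟨M, hM1, hM2, hM3⟩ := ((hE δ hδ).and (hMl.and (eventually_gt_atTop 0))).exists
  have hSM := (((hS M hM3).const_mul (3 * t ^ 2)).mul_const (Real.exp (2 * C))).eventually_lt_const
    (show 3 * t ^ 2 * 0 * Real.exp (2 * C) < ε / 3 by simpa using (by positivity : 0 < ε / 3))
  filter_upwards [hM1, hSM, hC] with n hn1 hn2 hn3
  have hb := isAdjacency_truncAdj (G n) (1 / p n) M
  have h1 := (hfam n).norm_integral_sub_truncated_le (hp0 n) (G n) hM3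
    (g := fun x => Complex.exp (Complex.I * (t * x : ℝ))) (by fun_prop) (B := 1) (fun x => by
      rw [mul_comm, Complex.norm_exp_ofReal_mul_I])
  have h2 := (hfam n).norm_integral_cexp_sub_le hb (hp0 n).le (hp1 n) t
  have h3 := hδε _ (by rw [Real.dist_eq]; exact hn1)
  rw [dist_eq_norm] at h3
  have h4 : 4 * 1 * edgeMass (adj (G n)) (p n) / M ≤ 4 * 1 * C / M := by gcongr
  have h5 : 3 * t ^ 2 * pathMass (truncAdj (G n) (1 / p n) M) (p n)
      * Real.exp (2 * edgeMass (truncAdj (G n) (1 / p n) M) (p n))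
      ≤ 3 * t ^ 2 * pathMass (truncAdj (G n) (1 / p n) M) (p n) * Real.exp (2 * C) := by
    have h6 := IsAdjacency.pathMass_nonneg (b := truncAdj (G n) (1 / p n) M) (hp0 n).le
    have h7 := (edgeMass_truncAdj_le (G n) (1 / p n) M (p n)).trans hn3
    gcongr
  rw [dist_eq_norm]
  refine (norm_sub_le_norm_sub_add_norm_sub _
    (∫ ω, Complex.exp (Complex.I * (t * matrixForm (truncAdj (G n) (1 / p n) M)
      (fun v => X n v ω) : ℝ)) ∂(P n)) _).trans_lt ?_
  have h8 := norm_sub_le_norm_sub_add_norm_sub (∫ ω, Complex.exp (Complex.I *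
    (t * matrixForm (truncAdj (G n) (1 / p n) M) (fun v => X n v ω) : ℝ)) ∂(P n))
    (Complex.exp (edgeMass (truncAdj (G n) (1 / p n) M) (p n)
      * (Complex.exp (Complex.I * t) - 1)))
    (Complex.exp ((lam : ℝ) * (Complex.exp (Complex.I * t) - 1)))
  calc _ ≤ 4 * 1 * C / M + (_ + _) := add_le_add (h1.trans h4) h8
    _ < ε / 3 + (ε / 3 + ε / 3) :=
      add_lt_add hM2 (add_lt_add ((h2.trans h5).trans_lt hn2) h3)
    _ = ε := by ring

/-- If the quadratic forms converge to a Poisson law, the truncated moments converge. -/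
theorem eventually_abs_integral_pow_sub_lt (hfam : ∀ n, IsBernoulliFamily (p n) (X n) (P n))
    (hp0 : ∀ n, 0 < p n) (hC : ∀ᶠ n in atTop, edgeMass (adj (G n)) (p n) ≤ C)
    (hT : TendstoInDistribution (fun n ω => quadForm (G n) (fun v => X n v ω)) atTop
      (fun k : ℕ => (k : ℝ)) P (poissonMeasure lam))
    {k : ℕ} (hk : k ≤ 2)
    (hi : Integrable (fun j : ℕ => (j : ℝ) ^ k) (poissonMeasure lam)) {ε : ℝ} (hε : 0 < ε) :
    ∀ᶠ M in atTop, ∀ᶠ n in atTop,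
      |∫ ω, matrixForm (truncAdj (G n) (1 / p n) M) (fun v => X n v ω) ^ k ∂(P n)
        - ∫ j : ℕ, (j : ℝ) ^ k ∂(poissonMeasure lam)| < ε := by
  set m := ∫ j : ℕ, (j : ℝ) ^ k ∂(poissonMeasure lam) with hm
  set g : ℝ → ℝ → ℝ := fun L x => min (|x| ^ k) (L ^ k) with hg
  have hgc : ∀ L, Continuous (g L) := fun L => by fun_prop
  have hgB : ∀ L, 0 ≤ L → ∀ x, ‖g L x‖ ≤ L ^ k := fun L hL x => by
    rw [Real.norm_of_nonneg (le_min (by positivity) (by positivity))]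
    exact min_le_right _ _
  have hconv : ∀ L, 0 ≤ L → Tendsto
      (fun n => ∫ ω, g L (matrixForm (adj (G n)) (fun v => X n v ω)) ∂(P n)) atTop
      (𝓝 (∫ j : ℕ, g L j ∂(poissonMeasure lam))) := by
    intro L hL
    have h1 := (ProbabilityMeasure.tendsto_iff_forall_integral_tendsto.1 hT.tendsto)
      (BoundedContinuousFunction.ofNormedAddCommGroup (g L) (hgc L) (L ^ k) (hgB L hL))
    simp only [ProbabilityMeasure.coe_mk, BoundedContinuousFunction.coe_ofNormedAddCommGroup] at h1
    rw [integral_map (Measurable.aemeasurable (by fun_prop)) (hgc L).aestronglyMeasurable] at h1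
    refine h1.congr fun n => ?_
    rw [integral_map (hT.forall_aemeasurable n) (hgc L).aestronglyMeasurable]
    rfl
  have hlim := tendsto_integral_poisson_min lam hi
  have hgm : ∀ L, 0 ≤ L → ∫ j : ℕ, g L j ∂(poissonMeasure lam) ≤ m := by
    intro L hL
    refine integral_mono_of_nonneg (Eventually.of_forall fun j => le_min (by positivity)
      (by positivity)) hi (Eventually.of_forall fun j => ?_)
    simp only [hg, Nat.abs_cast]
    exact min_le_left _ _
  -- For the lower bound the cut-off `L₀` must precede `M`, since the truncation error is of order
  -- `L₀ ^ k / M`.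
  obtain ⟨L₀, hL₀, hL₀'⟩ := ((hlim.eventually_const_lt (show m - ε / 3 < m by linarith)).and
    (eventually_ge_atTop 0)).exists
  have hMl : ∀ᶠ M : ℝ in atTop, 4 * L₀ ^ k * C / M < ε / 3 :=
    (tendsto_const_nhds.div_atTop tendsto_id).eventually_lt_const (by positivity)
  filter_upwards [hMl, eventually_gt_atTop 0] with M hM1 hM2
  -- For the upper bound `L` may depend on `M`, as it must, because the third-moment bound grows
  -- with `M`. No truncation error arises, since the truncated form is at most the full one.
  obtain ⟨L, hL1, hL⟩ := (((tendsto_const_nhds (x := (2 * C + 8 * M + 16) ^ 3)).div_atTop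
    tendsto_id).eventually_lt_const (show (0 : ℝ) < ε / 3 by positivity)
    |>.and (eventually_ge_atTop (1 : ℝ))).exists
  simp only [id] at hL1
  have hL0 : 0 ≤ L := by linarith
  filter_upwards [hC, (hconv L₀ hL₀').eventually_const_lt hL₀,
    (hconv L hL0).eventually_lt_const
      (show ∫ j : ℕ, g L j ∂(poissonMeasure lam) < m + ε / 3 by linarith [hgm L hL0])]
    with n hn1 hn2 hn3
  have hp := hp0 n
  have hb := isAdjacency_truncAdj (G n) (1 / p n) M
  set T : Ω n → ℝ := fun ω => matrixForm (truncAdj (G n) (1 / p n) M) (fun v => X n v ω) with hTd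
  have hTn : ∀ᵐ ω ∂(P n), 0 ≤ T ω := by
    filter_upwards [(hfam n).ae_nonneg] with ω hω
    exact hb.matrixForm_nonneg hω
  have hiT : ∀ j, Integrable (fun ω => T ω ^ j) (P n) := fun j =>
    (hfam n).integrable_comp (f := fun x => matrixForm (truncAdj (G n) (1 / p n) M) x ^ j)
      (by fun_prop)
  have hig : ∀ L, Integrable (fun ω => g L (T ω)) (P n) := fun L =>
    (hfam n).integrable_comp (f := fun x => g L (matrixForm (truncAdj (G n) (1 / p n) M) x))
      (by fun_prop)
  have hig' : Integrable (fun ω => g L (matrixForm (adj (G n)) (fun v => X n v ω))) (P n) :=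
    (hfam n).integrable_comp (f := fun x => g L (matrixForm (adj (G n)) x)) (by fun_prop)
  rw [abs_lt]
  constructor
  · have h1 := (hfam n).norm_integral_sub_truncated_le hp (G n) hM2 (hgc L₀) (hgB L₀ hL₀')
    have h2 : 4 * L₀ ^ k * edgeMass (adj (G n)) (p n) / M ≤ 4 * L₀ ^ k * C / M := by gcongr
    have h3 : ∫ ω, g L₀ (T ω) ∂(P n) ≤ ∫ ω, T ω ^ k ∂(P n) := by
      refine integral_mono_ae (hig L₀) (hiT k) ?_
      filter_upwards [hTn] with ω hω
      simp only [hg, abs_of_nonneg hω]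
      exact min_le_left _ _
    have h4 := (abs_le.1 (Real.norm_eq_abs _ ▸ h1)).2
    linarith
  · have hcube := (hfam n).integral_matrixForm_cube_le hb hp.le hM2.le (M := M) (fun u => by
      have h1 := (rowSum_truncAdj_le (G n) (1 / p n) M u).trans
        (deg_mul_lowDeg_le (G n) (1 / p n) M (by positivity) u)
      rw [mul_one_div, le_div_iff₀ hp] at h1
      linarith)
    have hE0 := hb.edgeMass_nonneg (p n)
    have hE1 := (edgeMass_truncAdj_le (G n) (1 / p n) M (p n)).trans hn1
    have hcube' : ∫ ω, T ω ^ 3 ∂(P n) ≤ (2 * C + 8 * M + 16) ^ 3 :=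
      hcube.trans (by gcongr)
    have h1 : ∫ ω, T ω ^ k ∂(P n) ≤ ∫ ω, (g L (matrixForm (adj (G n)) (fun v => X n v ω))
        + T ω ^ 3 / L) ∂(P n) := by
      refine integral_mono_ae (hiT k) (hig'.add ((hiT 3).div_const L)) ?_
      filter_upwards [hTn, (hfam n).ae_nonneg] with ω hω hX
      have hle : T ω ≤ matrixForm (adj (G n)) (fun v => X n v ω) :=
        mul_le_mul_of_nonneg_left (Finset.sum_le_sum fun u _ => Finset.sum_le_sum fun v _ =>
          mul_le_mul_of_nonneg_right (mul_le_mul_of_nonneg_right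
            (truncAdj_le_adj (G n) _ M u v) (hX u)) (hX v)) (by norm_num)
      have hgle : g L (T ω) ≤ g L (matrixForm (adj (G n)) (fun v => X n v ω)) := by
        simp only [hg]
        refine min_le_min ?_ le_rfl
        rw [abs_of_nonneg hω, abs_of_nonneg (hω.trans hle)]
        exact pow_le_pow_left₀ hω hle k
      refine le_trans ?_ (add_le_add hgle le_rfl)
      simp only [hg, abs_of_nonneg hω]
      rcases le_total (T ω) L with h2 | h2
      · rw [min_eq_left (pow_le_pow_left₀ hω h2 k)]
        have : 0 ≤ T ω ^ 3 / L := by positivity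
        linarith
      -- Beyond the cut-off, `1 ≤ L ≤ T` and `k ≤ 2` give `T ^ k ≤ T ^ 2 ≤ T ^ 3 / L`.
      · rw [min_eq_right (pow_le_pow_left₀ hL0 h2 k)]
        have h3 : T ω ^ k ≤ T ω ^ 2 := pow_le_pow_right₀ (hL.trans h2) hk
        have h4 : T ω ^ 2 ≤ T ω ^ 3 / L := by
          rw [le_div_iff₀ (by linarith), pow_succ (T ω) 2]
          gcongr
        have : 0 ≤ L ^ k := by positivity
        linarith
    rw [integral_add hig' ((hiT 3).div_const L), integral_div] at h1
    have h2 : (∫ ω, T ω ^ 3 ∂(P n)) / L ≤ (2 * C + 8 * M + 16) ^ 3 / L := by gcongr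
    linarith

end Sequences

/-! ### Discrete counterparts of the kernel integrals. -/

/-- The length of the part of the cell `(u p, (u + 1) p]` below `K`. -/
def nearLen (p K : ℝ) {n : ℕ} (u : Fin n) : ℝ := min (((u : ℕ) + 1) * p) K - min ((u : ℕ) * p) K

/-- The indicator function of the cell `(u p, (u + 1) p]`. -/
def cellInd (p : ℝ) {n : ℕ} (u : Fin n) : ℝ → ℝ :=
  (Set.Ioc ((u : ℕ) * p) (((u : ℕ) + 1) * p)).indicator (fun _ => 1)

/-- The truncated normalized degrees, integrated over `[0, K]`. -/
def nearDeg {n : ℕ} (G : SimpleGraph (Fin n)) (p K M : ℝ) : ℝ :=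
  ∑ u, nearLen p K u * (p * (deg G u * lowDeg G (1 / p) M u))

/-- The number of edges far away from the axes, in the normalization of `edgeMass`. -/
def farMass {n : ℕ} (G : SimpleGraph (Fin n)) (p K : ℝ) : ℝ :=
  (1 / 2) * ∑ u, ∑ v, adj G u v * ((p - nearLen p K u) * (p - nearLen p K v))

/-- The number of edges close to the origin, in the normalization of `edgeMass`. -/
def nearMass {n : ℕ} (G : SimpleGraph (Fin n)) (p K : ℝ) : ℝ :=
  ∑ u, ∑ v, adj G u v * (nearLen p K u * nearLen p K v)

section Cells

variable {n : ℕ} {p K : ℝ}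

lemma nearLen_nonneg (hp : 0 ≤ p) (u : Fin n) : 0 ≤ nearLen p K u := by
  have h : ((u : ℕ) : ℝ) * p ≤ ((u : ℕ) + 1) * p := by nlinarith
  exact sub_nonneg.2 (min_le_min h le_rfl)

lemma nearLen_le (hp : 0 ≤ p) (u : Fin n) : nearLen p K u ≤ p := by
  unfold nearLen
  rcases le_total (((u : ℕ) : ℝ) * p) K with h | h
  · rw [min_eq_left h]
    have := min_le_left ((((u : ℕ) : ℝ) + 1) * p) K
    nlinarith
  · rw [min_eq_right h]
    have := min_le_right ((((u : ℕ) : ℝ) + 1) * p) K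
    linarith

lemma nearLen_eq_of_le (u : Fin n) (h : (((u : ℕ) : ℝ) + 1) * p ≤ K) (hp : 0 ≤ p) :
    nearLen p K u = p := by
  rw [nearLen, min_eq_left h, min_eq_left (by nlinarith)]
  ring

lemma sum_nearLen_le (hK : 0 ≤ K) : ∑ u : Fin n, nearLen p K u ≤ K := by
  have h := Finset.sum_range_sub (fun i : ℕ => min ((i : ℝ) * p) K) n
  rw [← Fin.sum_univ_eq_sum_range (fun i : ℕ => min (((i + 1 : ℕ) : ℝ) * p) K - min ((i : ℝ) * p) K)]
    at h
  have h2 : ∑ u : Fin n, nearLen p K u = min ((n : ℝ) * p) K - min (((0 : ℕ) : ℝ) * p) K := by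
    rw [← h]
    refine Finset.sum_congr rfl fun u _ => ?_
    simp [nearLen]
  rw [h2, Nat.cast_zero, zero_mul, min_eq_left hK, sub_zero]
  exact min_le_right _ _

end Cells

/-! ### Comparison of near, far, edge and path masses. -/

section Estimates

variable {n : ℕ} {G : SimpleGraph (Fin n)} {p K M C : ℝ}

/-- The `u + 1` vertices up to `u` (indices start at zero) all have degree at least that of `u`, so
`(u + 1) * deg G u` is at most the sum of all degrees. -/
lemma deg_mul_le_two_mul_edgeMass (hG : ∀ u v : Fin n, u ≤ v → deg G v ≤ deg G u) (u : Fin n) :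
    (p * deg G u) * ((((u : ℕ) : ℝ) + 1) * p) ≤ 2 * edgeMass (adj G) p := by
  rw [← sum_deg_mul_sq, ← Finset.sum_mul]
  have h1 : ∑ w ∈ Finset.Iic u, (deg G u : ℝ) ≤ ∑ w, (deg G w : ℝ) :=
    (Finset.sum_le_sum fun w hw => by exact_mod_cast hG w u (Finset.mem_Iic.1 hw)).trans
      (Finset.sum_le_univ_sum_of_nonneg fun w => by positivity)
  rw [Finset.sum_const, Fin.card_Iic, nsmul_eq_mul] at h1
  push_cast at h1
  nlinarith [mul_le_mul_of_nonneg_right h1 (sq_nonneg p)]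

/-- Vertices whose cell reaches beyond `K` have a small degree. -/
lemma deg_mul_le_of_nearLen_lt (hG : ∀ u v : Fin n, u ≤ v → deg G v ≤ deg G u) (hp : 0 < p)
    (hC : edgeMass (adj G) p ≤ C) {u : Fin n} (hu : nearLen p K u < p) :
    p * deg G u * K ≤ 2 * C := by
  have h1 : K < (((u : ℕ) : ℝ) + 1) * p := by
    by_contra h
    exact hu.ne (nearLen_eq_of_le u (not_lt.1 h) hp.le)
  have h2 := deg_mul_le_two_mul_edgeMass (p := p) hG u
  have h3 : 0 ≤ p * deg G u := by positivity
  nlinarith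

/-- A cell reaching beyond `K` has normalized degree at most `2 C / K ≤ M`, so truncation at `M`
spares its vertex. -/
lemma lowDeg_eq_one_of_nearLen_lt (hG : ∀ u v : Fin n, u ≤ v → deg G v ≤ deg G u) (hp : 0 < p)
    (hC : edgeMass (adj G) p ≤ C) (hK : 0 < K) (hMK : 2 * C ≤ M * K) {u : Fin n}
    (hu : nearLen p K u < p) : lowDeg G (1 / p) M u = 1 := by
  refine lowDeg_of_le G _ M ?_
  have h := (deg_mul_le_of_nearLen_lt hG hp hC hu).trans hMK
  rw [mul_one_div, le_div_iff₀ hp]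
  have := le_of_mul_le_mul_right h hK
  linarith

lemma nearDeg_nonneg (hp : 0 ≤ p) : 0 ≤ nearDeg G p K M :=
  Finset.sum_nonneg fun u _ => mul_nonneg (nearLen_nonneg hp u)
    (mul_nonneg hp (mul_nonneg (by positivity) (lowDeg_nonneg _ _ _ _)))

lemma sum_adj_left (f : Fin n → ℝ) : ∑ u, ∑ v, adj G u v * f u = ∑ u, deg G u * f u := by
  simp only [← Finset.sum_mul, ← rowSum_adj, rowSum]

lemma sum_adj_right (f : Fin n → ℝ) : ∑ u, ∑ v, adj G u v * f v = ∑ u, deg G u * f u := by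
  rw [Finset.sum_comm, ← sum_adj_left]
  simp only [(isAdjacency_adj G).symm]

lemma edgeMass_truncAdj_eq : edgeMass (truncAdj G (1 / p) M) p
    = (1 / 2) * ∑ u, ∑ v, adj G u v
      * ((p * lowDeg G (1 / p) M u) * (p * lowDeg G (1 / p) M v)) := by
  rw [edgeMass]
  congr 1
  refine Finset.sum_congr rfl fun u _ => Finset.sum_congr rfl fun v _ => ?_
  rw [truncAdj]
  ring

/-- Truncating at large degrees and at small labels amounts to the same. -/
lemma abs_edgeMass_sub_farMass_le (hG : ∀ u v : Fin n, u ≤ v → deg G v ≤ deg G u) (hp : 0 < p)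
    (hC : edgeMass (adj G) p ≤ C) (hK : 0 < K) (hMK : 2 * C ≤ M * K) :
    |edgeMass (truncAdj G (1 / p) M) p - farMass G p K| ≤ nearDeg G p K M := by
  set t : Fin n → ℝ := fun u => p * lowDeg G (1 / p) M u with ht
  set w : Fin n → ℝ := fun u => p - nearLen p K u with hw
  have hw0 : ∀ u, 0 ≤ w u := fun u => sub_nonneg.2 (nearLen_le hp.le u)
  have hwp : ∀ u, w u ≤ p := fun u => sub_le_self _ (nearLen_nonneg hp.le u)
  have htp : ∀ u, t u ≤ p := fun u => mul_le_of_le_one_right hp.le (lowDeg_le_one _ _ _ _)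
  -- If the cell reaches beyond `K`, its vertex is not truncated and `t u = p`; otherwise `w u = 0`.
  have hwt : ∀ u, w u ≤ t u := fun u => by
    rcases (nearLen_le (K := K) hp.le u).lt_or_eq with h | h
    · simp only [ht, lowDeg_eq_one_of_nearLen_lt hG hp hC hK hMK h, mul_one]
      exact hwp u
    · simp only [hw, h, sub_self]
      exact mul_nonneg hp.le (lowDeg_nonneg _ _ _ _)
  have htw : ∀ u, t u - w u ≤ lowDeg G (1 / p) M u * nearLen p K u := fun u => by
    have h1 := lowDeg_le_one G (1 / p) M u
    have h2 := nearLen_le (K := K) hp.le u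
    simp only [ht, hw]
    nlinarith
  rw [edgeMass_truncAdj_eq, farMass]
  rw [← mul_sub, ← Finset.sum_sub_distrib]
  simp only [← Finset.sum_sub_distrib, ← mul_sub]
  have hpos : ∀ u v, 0 ≤ t u * t v - w u * w v := fun u v =>
    sub_nonneg.2 (mul_le_mul (hwt u) (hwt v) (hw0 v) ((hw0 u).trans (hwt u)))
  rw [abs_of_nonneg (mul_nonneg (by norm_num) (Finset.sum_nonneg fun u _ =>
    Finset.sum_nonneg fun v _ => mul_nonneg ((isAdjacency_adj G).nonneg u v) (hpos u v)))]
  have hle : ∀ u v, adj G u v * (t u * t v - w u * w v)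
      ≤ adj G u v * (p * (lowDeg G (1 / p) M u * nearLen p K u))
        + adj G u v * (p * (lowDeg G (1 / p) M v * nearLen p K v)) := fun u v => by
    rw [← mul_add]
    refine mul_le_mul_of_nonneg_left ?_ ((isAdjacency_adj G).nonneg u v)
    -- The difference of products is `(t u - w u) * t v + w u * (t v - w v)`, and `t v` and `w u`
    -- are at most `p`.
    have h1 : (t u - w u) * t v ≤ (t u - w u) * p :=
      mul_le_mul_of_nonneg_left (htp v) (sub_nonneg.2 (hwt u))
    have h2 : w u * (t v - w v) ≤ p * (t v - w v) :=
      mul_le_mul_of_nonneg_right (hwp u) (sub_nonneg.2 (hwt v))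
    have h3 := mul_le_mul_of_nonneg_left (htw u) hp.le
    have h4 := mul_le_mul_of_nonneg_left (htw v) hp.le
    linarith
  have hsum := Finset.sum_le_sum fun u (_ : u ∈ Finset.univ) =>
    Finset.sum_le_sum fun v (_ : v ∈ Finset.univ) => hle u v
  simp only [Finset.sum_add_distrib] at hsum
  rw [sum_adj_left (fun u => p * (lowDeg G (1 / p) M u * nearLen p K u)),
    sum_adj_right (fun u => p * (lowDeg G (1 / p) M u * nearLen p K u))] at hsum
  have heq : nearDeg G p K M = ∑ u, deg G u * (p * (lowDeg G (1 / p) M u * nearLen p K u)) :=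
    Finset.sum_congr rfl fun u _ => by ring
  rw [heq]
  linarith

/-- One factor `p` is split into the parts of the cell below and above `K`. Below, one of the two
truncated degrees is bounded by `M`; above, sortedness bounds it by `2 C / K` and the other sums to
at most `2 C`. -/
lemma pathMass_le_nearDeg (hG : ∀ u v : Fin n, u ≤ v → deg G v ≤ deg G u) (hp : 0 < p)
    (hC : edgeMass (adj G) p ≤ C) (hC0 : 0 ≤ C) (hK : 0 < K) (hM : 0 ≤ M) :
    pathMass (truncAdj G (1 / p) M) p ≤ M * nearDeg G p K M + (2 * C) ^ 2 / K := by
  have hle : ∀ u, p ^ 3 * rowSum (truncAdj G (1 / p) M) u ^ 2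
      ≤ M * (nearLen p K u * (p * (deg G u * lowDeg G (1 / p) M u)))
        + (deg G u * p ^ 2) * (2 * C / K) := by
    intro u
    set q : ℝ := p * (deg G u * lowDeg G (1 / p) M u) with hq
    have hl0 := lowDeg_nonneg G (1 / p) M u
    have hl1 := lowDeg_le_one G (1 / p) M u
    have hq0 : 0 ≤ q := by positivity
    have hqM : q ≤ M := by
      have := deg_mul_lowDeg_le G (1 / p) M (by positivity) u
      rw [mul_one_div, le_div_iff₀ hp] at this
      linarith
    have hqd : q ≤ p * deg G u :=
      mul_le_mul_of_nonneg_left (mul_le_of_le_one_right (by positivity) hl1) hp.le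
    have h1 : p ^ 3 * rowSum (truncAdj G (1 / p) M) u ^ 2 ≤ p * q ^ 2 := by
      have h2 := rowSum_truncAdj_le G (1 / p) M u
      have h3 := (isAdjacency_truncAdj G (1 / p) M).rowSum_nonneg u
      calc _ ≤ p ^ 3 * (deg G u * lowDeg G (1 / p) M u) ^ 2 := by gcongr
        _ = p * q ^ 2 := by rw [hq]; ring
    have hn0 := nearLen_nonneg (K := K) hp.le u
    have hnp := nearLen_le (K := K) hp.le u
    have h4 : nearLen p K u * q ^ 2 ≤ M * (nearLen p K u * q) := by
      nlinarith [mul_le_mul_of_nonneg_left hqM (mul_nonneg hn0 hq0)]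
    have h5 : (p - nearLen p K u) * q ^ 2 ≤ (deg G u * p ^ 2) * (2 * C / K) := by
      rcases hnp.lt_or_eq with h | h
      · have h6 := deg_mul_le_of_nearLen_lt hG hp hC h
        have h7 : q ≤ 2 * C / K := hqd.trans ((le_div_iff₀ hK).2 h6)
        calc (p - nearLen p K u) * q ^ 2 ≤ p * q ^ 2 := by
              refine mul_le_mul_of_nonneg_right ?_ (sq_nonneg q)
              linarith
          _ = p * (q * q) := by ring
          _ ≤ p * ((p * deg G u) * (2 * C / K)) := by gcongr
          _ = _ := by ring
      · rw [h, sub_self, zero_mul]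
        positivity
    linarith
  have hsum := Finset.sum_le_sum fun u (_ : u ∈ Finset.univ) => hle u
  rw [← Finset.mul_sum, Finset.sum_add_distrib, ← Finset.mul_sum, ← Finset.sum_mul,
    sum_deg_mul_sq] at hsum
  refine hsum.trans (add_le_add le_rfl ?_)
  calc 2 * edgeMass (adj G) p * (2 * C / K) ≤ 2 * C * (2 * C / K) := by gcongr
    _ = _ := by ring

/-- A vertex kept at level `M` loses at level `M'` only neighbours of degree above `M' / p`, whose
total mass is at most `2 C / M'`. What remains is linear in the row sum `s` and becomes quadratic
through `p s ≤ δ + (p s)² / δ`. -/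
lemma nearDeg_le_pathMass (hp : 0 < p) (hC : edgeMass (adj G) p ≤ C) (hK : 0 ≤ K) {M' δ : ℝ}
    (hM' : 0 < M') (hMM' : M ≤ M') (hδ : 0 < δ) :
    nearDeg G p K M ≤ δ * K + pathMass (truncAdj G (1 / p) M') p / δ + 2 * C / M' * K := by
  have hH : ∑ v, p * (1 - lowDeg G (1 / p) M' v) ≤ 2 * C / M' := by
    rw [le_div_iff₀ hM']
    linarith [mul_sum_one_sub_lowDeg_le G M' hp]
  have hle : ∀ u, nearLen p K u * (p * (deg G u * lowDeg G (1 / p) M u))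
      ≤ δ * nearLen p K u + p ^ 3 * rowSum (truncAdj G (1 / p) M') u ^ 2 / δ
        + 2 * C / M' * nearLen p K u := by
    intro u
    set s := rowSum (truncAdj G (1 / p) M') u with hs
    have hs0 : 0 ≤ s := (isAdjacency_truncAdj G (1 / p) M').rowSum_nonneg u
    have hn0 := nearLen_nonneg (K := K) hp.le u
    have hnp := nearLen_le (K := K) hp.le u
    have h1 : p * (deg G u * lowDeg G (1 / p) M u) ≤ p * s + 2 * C / M' := by
      rcases le_or_gt (deg G u : ℝ) (M * (1 / p)) with h | h
      · have hl : lowDeg G (1 / p) M' u = 1 := lowDeg_of_le G _ M'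
          (h.trans (mul_le_mul_of_nonneg_right hMM' (by positivity)))
        rw [lowDeg_of_le G _ M h, mul_one, ← rowSum_adj, rowSum]
        have h2 : ∑ v, adj G u v ≤ s + ∑ v, (1 - lowDeg G (1 / p) M' v) := by
          rw [hs, rowSum, ← Finset.sum_add_distrib]
          refine Finset.sum_le_sum fun v _ => ?_
          rw [truncAdj, hl]
          have h3 := (isAdjacency_adj G).le_one u v
          have h4 := lowDeg_le_one G (1 / p) M' v
          nlinarith
        have h5 := mul_le_mul_of_nonneg_left h2 hp.le
        rw [mul_add, Finset.mul_sum (s := Finset.univ)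
          (f := fun v => 1 - lowDeg G (1 / p) M' v)] at h5
        linarith
      · rw [lowDeg_of_lt G _ M h, mul_zero, mul_zero]
        have : 0 ≤ ∑ v, p * (1 - lowDeg G (1 / p) M' v) := Finset.sum_nonneg fun v _ =>
          mul_nonneg hp.le (sub_nonneg.2 (lowDeg_le_one _ _ _ _))
        have : 0 ≤ p * s := by positivity
        linarith
    have h2 : p * s ≤ δ + (p * s) ^ 2 / δ := by
      have h3 : 0 ≤ ((p * s) - δ) ^ 2 / δ + p * s := by positivity
      have h4 : ((p * s) - δ) ^ 2 / δ + p * s = δ + (p * s) ^ 2 / δ - p * s := by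
        field_simp
        ring
      linarith
    have h5 : nearLen p K u * ((p * s) ^ 2 / δ) ≤ p ^ 3 * s ^ 2 / δ := by
      calc nearLen p K u * ((p * s) ^ 2 / δ) ≤ p * ((p * s) ^ 2 / δ) := by gcongr
        _ = _ := by ring
    have h6 := mul_le_mul_of_nonneg_left h1 hn0
    have h7 := mul_le_mul_of_nonneg_left h2 hn0
    linarith
  have hsum := Finset.sum_le_sum fun u (_ : u ∈ Finset.univ) => hle u
  rw [Finset.sum_add_distrib, Finset.sum_add_distrib, ← Finset.mul_sum, ← Finset.mul_sum,
    ← Finset.sum_div, ← Finset.mul_sum] at hsum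
  have hC0 : 0 ≤ C := ((isAdjacency_adj G).edgeMass_nonneg p).trans hC
  have hS := sum_nearLen_le (n := n) (p := p) hK
  refine hsum.trans ?_
  rw [pathMass]
  gcongr

/-- An edge with a low-degree endpoint is charged to that endpoint, with weight at most `p` for the
other one. Pairs of high-degree vertices contribute at most the square of their total mass. -/
lemma nearMass_le_nearDeg (hp : 0 < p) (hC : edgeMass (adj G) p ≤ C) (hM : 0 < M) :
    nearMass G p K ≤ 2 * nearDeg G p K M + (2 * C / M) ^ 2 := by
  set l := lowDeg G (1 / p) M with hl
  have hH : ∑ v, p * (1 - l v) ≤ 2 * C / M := by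
    rw [le_div_iff₀ hM]
    linarith [mul_sum_one_sub_lowDeg_le G M hp]
  have hH0 : 0 ≤ ∑ v, p * (1 - l v) := Finset.sum_nonneg fun v _ =>
    mul_nonneg hp.le (sub_nonneg.2 (lowDeg_le_one _ _ _ _))
  have hle : ∀ u v, adj G u v * (nearLen p K u * nearLen p K v)
      ≤ adj G u v * (p * (l u * nearLen p K u)) + adj G u v * (p * (l v * nearLen p K v))
        + (p * (1 - l u)) * (p * (1 - l v)) := by
    intro u v
    have hu0 := nearLen_nonneg (K := K) hp.le u
    have hup := nearLen_le (K := K) hp.le u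
    have hv0 := nearLen_nonneg (K := K) hp.le v
    have hvp := nearLen_le (K := K) hp.le v
    have h0 : ∀ w, 0 ≤ l w := lowDeg_nonneg G (1 / p) M
    have h1 : ∀ w, 0 ≤ 1 - l w := fun w => sub_nonneg.2 (lowDeg_le_one G (1 / p) M w)
    have e0 : nearLen p K u * nearLen p K v
        ≤ (p * (l u * nearLen p K u)) + (p * (l v * nearLen p K v))
        + (p * (1 - l u)) * (p * (1 - l v)) := by
      have e1 : l u * (nearLen p K u * nearLen p K v) ≤ l u * (nearLen p K u * p) := by
        have := h0 u
        gcongr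
      have e2 : l v * (nearLen p K u * nearLen p K v) ≤ l v * (p * nearLen p K v) := by
        have := h0 v
        gcongr
      have e3 : (1 - l u) * (1 - l v) * (nearLen p K u * nearLen p K v)
          ≤ (1 - l u) * (1 - l v) * (p * p) := by
        have := mul_nonneg (h1 u) (h1 v)
        gcongr
      have e4 : 0 ≤ l u * l v * (nearLen p K u * nearLen p K v) :=
        mul_nonneg (mul_nonneg (h0 u) (h0 v)) (mul_nonneg hu0 hv0)
      nlinarith
    have e5 : 0 ≤ (p * (1 - l u)) * (p * (1 - l v)) :=
      mul_nonneg (mul_nonneg hp.le (h1 u)) (mul_nonneg hp.le (h1 v))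
    rcases (isAdjacency_adj G).zero_or_one u v with h | h
    · simpa [h] using e5
    · simpa [h] using e0
  have hsum := Finset.sum_le_sum fun u (_ : u ∈ Finset.univ) =>
    Finset.sum_le_sum fun v (_ : v ∈ Finset.univ) => hle u v
  simp only [Finset.sum_add_distrib] at hsum
  rw [sum_adj_left (fun u => p * (l u * nearLen p K u)),
    sum_adj_right (fun u => p * (l u * nearLen p K u)), ← Finset.sum_mul_sum, ← sq] at hsum
  have heq : nearDeg G p K M = ∑ u, deg G u * (p * (l u * nearLen p K u)) :=
    Finset.sum_congr rfl fun u _ => by ring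
  have hsq : (∑ v, p * (1 - l v)) ^ 2 ≤ (2 * C / M) ^ 2 := pow_le_pow_left₀ hH0 hH 2
  rw [heq]
  refine hsum.trans ?_
  linarith

end Estimates

/-! ### Evaluation of the kernel integrals on cells. -/

section KernelIntegrals

variable {n : ℕ} {p K M : ℝ}

lemma cellInd_of_mem {u : Fin n} {x : ℝ}
    (h : x ∈ Set.Ioc (((u : ℕ) : ℝ) * p) ((((u : ℕ) : ℝ) + 1) * p)) : cellInd p u x = 1 :=
  Set.indicator_of_mem h _

lemma cellInd_of_notMem {u : Fin n} {x : ℝ}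
    (h : x ∉ Set.Ioc (((u : ℕ) : ℝ) * p) ((((u : ℕ) : ℝ) + 1) * p)) : cellInd p u x = 0 :=
  Set.indicator_of_notMem h _

lemma integrable_cellInd (p : ℝ) (u : Fin n) : Integrable (cellInd p u) :=
  (integrable_indicator_iff measurableSet_Ioc).2 (integrableOn_const (by simp))

/-- The ceiling makes the cells open on the left, so `x = 0` belongs to none; index `u` carries the
label `u + 1`. -/
lemma mem_cell_iff (hp : 0 < p) (u : Fin n) (x : ℝ) :
    (u : ℕ) + 1 = ⌈x * (1 / p)⌉₊
      ↔ x ∈ Set.Ioc (((u : ℕ) : ℝ) * p) ((((u : ℕ) : ℝ) + 1) * p) := by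
  rw [eq_comm, Nat.ceil_eq_iff (Nat.succ_ne_zero _), Nat.succ_sub_one, mul_one_div,
    lt_div_iff₀ hp, div_le_iff₀ hp, Set.mem_Ioc]
  push_cast
  rfl

lemma cellInd_of_ne (hp : 0 < p) {u v : Fin n} {x : ℝ}
    (hx : x ∈ Set.Ioc (((u : ℕ) : ℝ) * p) ((((u : ℕ) : ℝ) + 1) * p)) (huv : v ≠ u) :
    cellInd p v x = 0 := by
  refine cellInd_of_notMem fun hv => huv ?_
  have h1 := (mem_cell_iff hp u x).2 hx
  have h2 := (mem_cell_iff hp v x).2 hv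
  exact Fin.ext (by omega)

lemma sum_mul_cellInd (hp : 0 < p) (f : Fin n → ℝ) {u : Fin n} {x : ℝ}
    (hx : x ∈ Set.Ioc (((u : ℕ) : ℝ) * p) ((((u : ℕ) : ℝ) + 1) * p)) :
    ∑ v, f v * cellInd p v x = f u := by
  rw [Finset.sum_eq_single u (fun v _ hv => by rw [cellInd_of_ne hp hx hv, mul_zero]) (by simp),
    cellInd_of_mem hx, mul_one]

/-- Since the cells are disjoint, at most one term survives. This step-function form turns all later
integrals into finite sums. -/
lemma graphKernel_eq (G : SimpleGraph (Fin n)) (hp : 0 < p) (x y : ℝ) :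
    graphKernel G (1 / p) x y = ∑ u, (∑ v, adj G u v * cellInd p v y) * cellInd p u x := by
  by_cases hx : ∃ u : Fin n, x ∈ Set.Ioc (((u : ℕ) : ℝ) * p) ((((u : ℕ) : ℝ) + 1) * p)
  · obtain ⟨u, hu⟩ := hx
    rw [sum_mul_cellInd hp _ hu]
    by_cases hy : ∃ v : Fin n, y ∈ Set.Ioc (((v : ℕ) : ℝ) * p) ((((v : ℕ) : ℝ) + 1) * p)
    · obtain ⟨v, hv⟩ := hy
      rw [sum_mul_cellInd hp _ hv]
      have hu' := (mem_cell_iff hp u x).2 hu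
      have hv' := (mem_cell_iff hp v y).2 hv
      by_cases h : G.Adj u v
      · rw [graphKernel, if_pos ⟨u, v, hu', hv', h⟩, adj, if_pos h]
      · rw [graphKernel, if_neg, adj, if_neg h]
        rintro ⟨u', v', h1, h2, h3⟩
        have e1 : u' = u := Fin.ext (by omega)
        have e2 : v' = v := Fin.ext (by omega)
        exact h (e1 ▸ e2 ▸ h3)
    · push Not at hy
      rw [graphKernel, if_neg]
      · simp [cellInd_of_notMem (hy _)]
      · rintro ⟨u', v', h1, h2, h3⟩
        exact hy v' ((mem_cell_iff hp v' y).1 h2)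
  · push Not at hx
    rw [graphKernel, if_neg]
    · simp [cellInd_of_notMem (hx _)]
    · rintro ⟨u', v', h1, h2, h3⟩
      exact hx u' ((mem_cell_iff hp u' x).1 h1)

lemma setIntegral_cellInd (s : Set ℝ) (u : Fin n) :
    ∫ x in s, cellInd p u x
      = volume.real (s ∩ Set.Ioc (((u : ℕ) : ℝ) * p) ((((u : ℕ) : ℝ) + 1) * p)) := by
  rw [cellInd, setIntegral_indicator measurableSet_Ioc, setIntegral_const]
  simp

lemma setIntegral_Icc_cellInd (hp : 0 ≤ p) (u : Fin n) :
    ∫ x in Set.Icc 0 K, cellInd p u x = nearLen p K u := by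
  rw [integral_Icc_eq_integral_Ioc, setIntegral_cellInd, Set.Ioc_inter_Ioc,
    sup_eq_right.2 (by positivity), Real.volume_real_Ioc]
  have h0 := nearLen_nonneg (K := K) hp u
  have h1 : ((u : ℕ) : ℝ) * p ≤ (((u : ℕ) : ℝ) + 1) * p := by nlinarith
  unfold nearLen at h0 ⊢
  rw [inf_comm]
  change max (min ((((u : ℕ) : ℝ) + 1) * p) K - ((u : ℕ) : ℝ) * p) 0 = _
  rcases le_total (((u : ℕ) : ℝ) * p) K with h | h
  · rw [min_eq_left h, max_eq_left (sub_nonneg.2 (le_min h1 h))]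
  · rw [min_eq_right h, min_eq_right (h.trans h1), max_eq_right (sub_nonpos.2 h), sub_self]

lemma setIntegral_Ioi_cellInd (hp : 0 ≤ p) (u : Fin n) :
    ∫ x in Set.Ioi K, cellInd p u x = p - nearLen p K u := by
  rw [setIntegral_cellInd, Set.inter_comm, Set.Ioc_inter_Ioi,
    Real.volume_real_Ioc]
  have h1 : ((u : ℕ) : ℝ) * p ≤ (((u : ℕ) : ℝ) + 1) * p := by nlinarith
  unfold nearLen
  rcases le_total (((u : ℕ) : ℝ) * p) K with h | h
  · rw [min_eq_left h, sup_eq_right.2 h]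
    rcases le_total ((((u : ℕ) : ℝ) + 1) * p) K with h' | h'
    · rw [min_eq_left h', max_eq_right (sub_nonpos.2 h')]
      ring
    · rw [min_eq_right h', max_eq_left (sub_nonneg.2 h')]
      ring
  · rw [min_eq_right h, sup_eq_left.2 h, min_eq_right (h.trans h1),
      max_eq_left (sub_nonneg.2 h1)]
    ring

lemma setIntegral_Ioi_zero_cellInd (hp : 0 ≤ p) (u : Fin n) :
    ∫ x in Set.Ioi 0, cellInd p u x = p := by
  rw [setIntegral_Ioi_cellInd hp, nearLen, min_eq_right (by positivity),
    min_eq_right (by positivity)]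
  ring

lemma half_integral_Ioi_graphKernel (G : SimpleGraph (Fin n)) (hp : 0 < p) :
    (1 / 2) * ∫ x in Set.Ioi K, ∫ y in Set.Ioi K, graphKernel G (1 / p) x y = farMass G p K := by
  have h1 : ∀ x, ∫ y in Set.Ioi K, graphKernel G (1 / p) x y
      = ∑ u, (∑ v, adj G u v * (p - nearLen p K v)) * cellInd p u x := by
    intro x
    simp only [graphKernel_eq G hp]
    rw [integral_finsetSum _ fun u _ => Integrable.mul_const (integrable_finsetSum _ fun v _ =>
      (integrable_cellInd p v).integrableOn.const_mul _) _]
    refine Finset.sum_congr rfl fun u _ => ?_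
    rw [integral_mul_const, integral_finsetSum _ fun v _ =>
      (integrable_cellInd p v).integrableOn.const_mul _]
    congr 1
    refine Finset.sum_congr rfl fun v _ => ?_
    rw [integral_const_mul, setIntegral_Ioi_cellInd hp.le]
  simp only [h1]
  rw [integral_finsetSum _ fun u _ => (integrable_cellInd p u).integrableOn.const_mul _, farMass]
  congr 1
  refine Finset.sum_congr rfl fun u _ => ?_
  rw [integral_const_mul, setIntegral_Ioi_cellInd hp.le, Finset.sum_mul]
  exact Finset.sum_congr rfl fun v _ => by ring

lemma normDeg_graphKernel (G : SimpleGraph (Fin n)) (hp : 0 < p) (x : ℝ) :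
    normDeg (graphKernel G (1 / p)) x = ∑ u, (p * deg G u) * cellInd p u x := by
  unfold normDeg
  simp only [graphKernel_eq G hp]
  rw [integral_finsetSum _ fun u _ => Integrable.mul_const (integrable_finsetSum _ fun v _ =>
    (integrable_cellInd p v).integrableOn.const_mul _) _]
  refine Finset.sum_congr rfl fun u _ => ?_
  rw [integral_mul_const, integral_finsetSum _ fun v _ =>
    (integrable_cellInd p v).integrableOn.const_mul _]
  congr 1
  simp only [integral_const_mul, setIntegral_Ioi_zero_cellInd hp.le]
  rw [← rowSum_adj, rowSum, ← Finset.sum_mul, mul_comm]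

lemma truncFun_normDeg (G : SimpleGraph (Fin n)) (hp : 0 < p) (M x : ℝ) :
    truncFun M (normDeg (graphKernel G (1 / p))) x
      = ∑ u, (p * (deg G u * lowDeg G (1 / p) M u)) * cellInd p u x := by
  by_cases hx : ∃ u : Fin n, x ∈ Set.Ioc (((u : ℕ) : ℝ) * p) ((((u : ℕ) : ℝ) + 1) * p)
  · obtain ⟨u, hu⟩ := hx
    rw [sum_mul_cellInd hp _ hu, truncFun, normDeg_graphKernel G hp, sum_mul_cellInd hp _ hu]
    have h : (p * deg G u ≤ M) ↔ ((deg G u : ℝ) ≤ M * (1 / p)) := by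
      rw [mul_one_div, le_div_iff₀ hp, mul_comm]
    by_cases h1 : (deg G u : ℝ) ≤ M * (1 / p)
    · rw [if_pos (h.2 h1), lowDeg_of_le G _ M h1, mul_one]
    · rw [if_neg (fun h2 => h1 (h.1 h2)), lowDeg_of_lt G _ M (not_le.1 h1), mul_zero, mul_zero]
  · push Not at hx
    have h0 : normDeg (graphKernel G (1 / p)) x = 0 := by
      rw [normDeg_graphKernel G hp]
      simp [cellInd_of_notMem (hx _)]
    rw [truncFun, h0, ite_self]
    simp [cellInd_of_notMem (hx _)]

lemma integral_abs_truncFun_sub (G : SimpleGraph (Fin n)) (hp : 0 < p) (K M : ℝ) :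
    ∫ x in Set.Icc (0 : ℝ) K, |truncFun M (normDeg (graphKernel G (1 / p))) x
      - truncFun M (fun _ => 0) x| = nearDeg G p K M := by
  have h1 : ∀ x, |truncFun M (normDeg (graphKernel G (1 / p))) x - truncFun M (fun _ => 0) x|
      = ∑ u, (p * (deg G u * lowDeg G (1 / p) M u)) * cellInd p u x := by
    intro x
    have h2 : truncFun M (fun _ : ℝ => 0) x = 0 := by simp [truncFun]
    rw [h2, sub_zero, truncFun_normDeg G hp, abs_of_nonneg]
    refine Finset.sum_nonneg fun u _ => mul_nonneg (mul_nonneg hp.le (mul_nonneg (by positivity)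
      (lowDeg_nonneg _ _ _ _))) (Set.indicator_nonneg (fun _ _ => zero_le_one) _)
  simp only [h1]
  rw [integral_finsetSum _ fun u _ => (integrable_cellInd p u).integrableOn.const_mul _, nearDeg]
  refine Finset.sum_congr rfl fun u _ => ?_
  rw [integral_const_mul, setIntegral_Icc_cellInd hp.le, mul_comm]

lemma cutDist_nonneg (K : ℝ) (W₁ W₂ : ℝ → ℝ → ℝ) : 0 ≤ cutDist K W₁ W₂ := by
  refine Real.sSup_nonneg ?_
  rintro c ⟨f, g, -, -, -, -, rfl⟩
  exact abs_nonneg _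

/-- The kernel is nonnegative, so test functions with values in `[-1, 1]` cannot exceed its
integral. -/
lemma cutDist_graphKernel_zero_le (G : SimpleGraph (Fin n)) (hp : 0 < p) :
    cutDist K (graphKernel G (1 / p)) (fun _ _ => 0) ≤ nearMass G p K := by
  have hfun : ∀ z : ℝ × ℝ, graphKernel G (1 / p) z.1 z.2
      = ∑ u, ∑ v, adj G u v * (cellInd p u z.1 * cellInd p v z.2) := by
    intro z
    rw [graphKernel_eq G hp]
    refine Finset.sum_congr rfl fun u _ => ?_
    rw [Finset.sum_mul]
    exact Finset.sum_congr rfl fun v _ => by ring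
  have hint : ∀ u v : Fin n, Integrable (fun z : ℝ × ℝ =>
      adj G u v * (cellInd p u z.1 * cellInd p v z.2)) := fun u v =>
    ((integrable_cellInd p u).mul_prod (integrable_cellInd p v)).const_mul _
  have hW : Integrable (fun z : ℝ × ℝ => graphKernel G (1 / p) z.1 z.2) := by
    simp only [hfun]
    exact integrable_finsetSum _ fun u _ => integrable_finsetSum _ fun v _ => hint u v
  have hval : ∫ z in Set.Icc (0 : ℝ) K ×ˢ Set.Icc (0 : ℝ) K, graphKernel G (1 / p) z.1 z.2
      = nearMass G p K := by
    simp only [hfun]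
    rw [integral_finsetSum _ fun u _ => integrable_finsetSum _ fun v _ => (hint u v).integrableOn,
      nearMass]
    refine Finset.sum_congr rfl fun u _ => ?_
    rw [integral_finsetSum _ fun v _ => (hint u v).integrableOn]
    refine Finset.sum_congr rfl fun v _ => ?_
    rw [integral_const_mul, Measure.volume_eq_prod, setIntegral_prod_mul,
      setIntegral_Icc_cellInd hp.le, setIntegral_Icc_cellInd hp.le]
  refine csSup_le ⟨_, 0, 0, measurable_const, measurable_const, by simp, by simp, rfl⟩ ?_
  rintro c ⟨f, g, -, -, hf, hg, rfl⟩
  rw [← Real.norm_eq_abs, ← hval]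
  refine norm_integral_le_of_norm_le hW.integrableOn (Eventually.of_forall fun z => ?_)
  have h0 : 0 ≤ graphKernel G (1 / p) z.1 z.2 := by
    unfold graphKernel
    split_ifs <;> norm_num
  have hf' : |f z.1| ≤ 1 := abs_le.2 ⟨(hf z.1).1, (hf z.1).2⟩
  have hg' : |g z.2| ≤ 1 := abs_le.2 ⟨(hg z.2).1, (hg z.2).2⟩
  rw [sub_zero, Real.norm_eq_abs, abs_mul, abs_mul, abs_of_nonneg h0]
  exact (mul_le_of_le_one_right (by positivity) hg').trans (mul_le_of_le_one_right h0 hf')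

end KernelIntegrals

/-! ### Vanishing path mass against the limit hypotheses and the variance condition. -/

section Equivalences

variable {G : (n : ℕ) → SimpleGraph (Fin n)} {p : ℕ → ℝ} {C lam : ℝ}

/-- In `nearDeg_le_pathMass`, `M'` is taken large and `δ` small before `n → ∞`, so that `pathMass`
divided by the fixed `δ` still vanishes. -/
lemma tendsto_nearDeg (hp0 : ∀ n, 0 < p n)
    (hC : ∀ᶠ n in atTop, edgeMass (adj (G n)) (p n) ≤ C)
    (hS : ∀ M > 0, Tendsto (fun n => pathMass (truncAdj (G n) (1 / p n) M) (p n)) atTop (𝓝 0))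
    {K : ℝ} (hK : 0 ≤ K) (M : ℝ) :
    Tendsto (fun n => nearDeg (G n) (p n) K M) atTop (𝓝 0) := by
  rw [Metric.tendsto_nhds]
  intro ε hε
  obtain ⟨M', hM'1, hM'2, hM'3⟩ :=
    ((((tendsto_const_nhds (x := 2 * C)).div_atTop tendsto_id).mul_const K).eventually_lt_const
      (show 0 * K < ε / 3 by simpa using (by positivity : 0 < ε / 3))
      |>.and ((eventually_gt_atTop 0).and (eventually_ge_atTop M))).exists
  simp only [id] at hM'1
  -- `K + 1` avoids division by zero at `K = 0`.
  have hδ : 0 < ε / (3 * (K + 1)) := by positivity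
  have hδK : ε / (3 * (K + 1)) * K < ε / 3 := by
    rw [div_mul_eq_mul_div, div_lt_div_iff₀ (by positivity) (by norm_num)]
    nlinarith
  filter_upwards [hC, ((hS M' hM'2).div_const (ε / (3 * (K + 1)))).eventually_lt_const
    (show 0 / (ε / (3 * (K + 1))) < ε / 3 by simpa using (by positivity : 0 < ε / 3))]
    with n hn1 hn2
  rw [dist_zero_right, Real.norm_of_nonneg (nearDeg_nonneg (hp0 n).le)]
  have := nearDeg_le_pathMass (M := M) (hp0 n) hn1 hK hM'2 hM'3 hδ
  linarith

/-- The conditions on the truncated moments imply the hypotheses of the limit theorem. -/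
lemma limitHypotheses_of_tendsto_pathMass
    (hG : ∀ n, ∀ u v : Fin n, u ≤ v → deg (G n) v ≤ deg (G n) u) (hp0 : ∀ n, 0 < p n)
    (hC : ∀ᶠ n in atTop, edgeMass (adj (G n)) (p n) ≤ C)
    (hS : ∀ M > 0, Tendsto (fun n => pathMass (truncAdj (G n) (1 / p n) M) (p n)) atTop (𝓝 0))
    (hE : ∀ ε > 0, ∀ᶠ M in atTop, ∀ᶠ n in atTop,
      |edgeMass (truncAdj (G n) (1 / p n) M) (p n) - lam| < ε) :
    LimitHypotheses G (fun n => 1 / p n) (fun _ _ => 0) (fun _ => 0) lam where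
  residual := by
    rw [doubleLimit_iff]
    intro ε hε
    -- A single good `M` serves every `K ≥ 2 * C / M`, since `2 * C ≤ M * K` is all that the
    -- comparison with `farMass` needs.
    obtain ⟨M, hM1, hM2⟩ := ((hE (ε / 2) (by positivity)).and (eventually_gt_atTop 0)).exists
    filter_upwards [eventually_gt_atTop 0, eventually_ge_atTop (2 * C / M)] with K hK1 hK2
    filter_upwards [hC, hM1, (tendsto_nearDeg hp0 hC hS hK1.le M).eventually_lt_const
      (show 0 < ε / 2 by positivity)] with n hn1 hn2 hn3
    rw [half_integral_Ioi_graphKernel _ (hp0 n)]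
    have h1 := abs_edgeMass_sub_farMass_le (hG n) (hp0 n) hn1 hK1
      (by rw [div_le_iff₀ hM2] at hK2; linarith : 2 * C ≤ M * K)
    rw [abs_sub_comm] at h1
    refine (abs_sub_le _ (edgeMass (truncAdj (G n) (1 / p n) M) (p n)) _).trans_lt ?_
    linarith
  kernel := ⟨measurable_const, fun _ _ _ _ => rfl, fun _ _ _ _ => by simp⟩
  tendsto_cutDist := by
    refine ⟨1, one_pos, fun K hK => ?_⟩
    have hK0 : 0 ≤ K := by linarith
    rw [Metric.tendsto_nhds]
    intro ε hε
    obtain ⟨M, hM1, hM2⟩ := ((((tendsto_const_nhds (x := 2 * C)).div_atTop tendsto_id).pow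
      2).eventually_lt_const (show (0 : ℝ) ^ 2 < ε / 2 by simpa using hε)
      |>.and (eventually_gt_atTop 0)).exists
    simp only [id] at hM1
    filter_upwards [hC, (tendsto_nearDeg hp0 hC hS hK0 M).eventually_lt_const
      (show 0 < ε / 4 by positivity)] with n hn1 hn2
    rw [dist_zero_right, Real.norm_of_nonneg (cutDist_nonneg _ _ _)]
    have h1 := cutDist_graphKernel_zero_le (K := K) (G n) (hp0 n)
    have h2 := nearMass_le_nearDeg (K := K) (hp0 n) hn1 hM2
    linarith
  deg_measurable := measurable_const
  deg_nonneg := fun _ _ => le_rfl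
  deg_integrable := integrableOn_zero
  tendsto_deg := by
    refine ⟨1, 1, one_pos, one_pos, fun K hK M _ => ?_⟩
    simp only [integral_abs_truncFun_sub _ (hp0 _)]
    exact tendsto_nearDeg hp0 hC hS (by linarith) M

lemma tendsto_pathMass_of_limitHypotheses
    (hG : ∀ n, ∀ u v : Fin n, u ≤ v → deg (G n) v ≤ deg (G n) u) (hp0 : ∀ n, 0 < p n)
    (hC : ∀ᶠ n in atTop, edgeMass (adj (G n)) (p n) ≤ C) (hC0 : 0 ≤ C)
    (h : LimitHypotheses G (fun n => 1 / p n) (fun _ _ => 0) (fun _ => 0) lam) (M : ℝ) :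
    Tendsto (fun n => pathMass (truncAdj (G n) (1 / p n) M) (p n)) atTop (𝓝 0) := by
  obtain ⟨K₀, M₀, hK₀, hM₀, hD⟩ := h.tendsto_deg
  simp only [integral_abs_truncFun_sub _ (hp0 _)] at hD
  rw [Metric.tendsto_nhds]
  intro ε hε
  obtain ⟨K, hK1, hK2⟩ := (((tendsto_const_nhds (x := (2 * C) ^ 2)).div_atTop
    tendsto_id).eventually_lt_const (show (0 : ℝ) < ε / 2 by positivity)
    |>.and (eventually_ge_atTop K₀)).exists
  simp only [id] at hK1
  -- The degree condition is available from `M₀` on; smaller levels follow because `pathMass`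
  -- increases with the level.
  filter_upwards [hC, ((hD K hK2 (max M M₀) (le_max_right _ _)).const_mul
    (max M M₀)).eventually_lt_const (show max M M₀ * 0 < ε / 2 by simpa using hε)] with n hn1 hn2
  have hp := hp0 n
  rw [dist_zero_right, Real.norm_of_nonneg (IsAdjacency.pathMass_nonneg hp.le)]
  have h1 := pathMass_truncAdj_mono (G n) (r := 1 / p n) (by positivity) (le_max_left M M₀) hp.le
  have h2 := pathMass_le_nearDeg (hG n) hp hn1 hC0 (K := K) (hK₀.trans_le hK2) (M := max M M₀)
    (hM₀.le.trans (le_max_right _ _))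
  linarith

/-- With `K` fixed so that the far mass is close to `lam`, every large `M` works, the discrepancy
being at most `nearDeg`. -/
lemma eventually_edgeMass_of_limitHypotheses
    (hG : ∀ n, ∀ u v : Fin n, u ≤ v → deg (G n) v ≤ deg (G n) u) (hp0 : ∀ n, 0 < p n)
    (hC : ∀ᶠ n in atTop, edgeMass (adj (G n)) (p n) ≤ C)
    (h : LimitHypotheses G (fun n => 1 / p n) (fun _ _ => 0) (fun _ => 0) lam) {ε : ℝ}
    (hε : 0 < ε) : ∀ᶠ M in atTop, ∀ᶠ n in atTop,
      |edgeMass (truncAdj (G n) (1 / p n) M) (p n) - lam| < ε := by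
  obtain ⟨K₀, M₀, hK₀, hM₀, hD⟩ := h.tendsto_deg
  simp only [integral_abs_truncFun_sub _ (hp0 _)] at hD
  obtain ⟨K, hK1, hK2⟩ := ((doubleLimit_iff.1 h.residual (ε / 2) (by positivity)).and
    (eventually_ge_atTop K₀)).exists
  have hK := hK₀.trans_le hK2
  filter_upwards [eventually_ge_atTop M₀, eventually_ge_atTop (2 * C / K)] with M hM1 hM2
  filter_upwards [hC, hK1, (hD K hK2 M hM1).eventually_lt_const
    (show 0 < ε / 2 by positivity)] with n hn1 hn2 hn3
  rw [half_integral_Ioi_graphKernel _ (hp0 n)] at hn2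
  have h1 := abs_edgeMass_sub_farMass_le (hG n) (hp0 n) hn1 hK ((div_le_iff₀ hK).1 hM2)
  refine (abs_sub_le _ (farMass (G n) (p n) K) _).trans_lt ?_
  linarith

/-- If mean and variance of the truncated forms have the same double limit, then the number of
paths in the truncated graphs is negligible. -/
lemma tendsto_pathMass_of_variance (hp0 : ∀ n, 0 < p n) (hp : Tendsto p atTop (𝓝 0))
    (hC : ∀ᶠ n in atTop, edgeMass (adj (G n)) (p n) ≤ C)
    (hE : ∀ ε > 0, ∀ᶠ M in atTop, ∀ᶠ n in atTop,
      |edgeMass (truncAdj (G n) (1 / p n) M) (p n) - lam| < ε)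
    (hV : ∀ ε > 0, ∀ᶠ M in atTop, ∀ᶠ n in atTop,
      |(1 - p n) * pathMass (truncAdj (G n) (1 / p n) M) (p n)
        + edgeMass (truncAdj (G n) (1 / p n) M) (p n) * (1 - p n) ^ 2 - lam| < ε) (M₀ : ℝ) :
    Tendsto (fun n => pathMass (truncAdj (G n) (1 / p n) M₀) (p n)) atTop (𝓝 0) := by
  rw [Metric.tendsto_nhds]
  intro ε hε
  obtain ⟨M, hM1, hM2, hM3⟩ := ((hE (ε / 8) (by positivity)).and
    ((hV (ε / 8) (by positivity)).and (eventually_ge_atTop M₀))).exists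
  filter_upwards [hC, hM1, hM2, hp.eventually_lt_const (show (0 : ℝ) < 1 / 2 by norm_num),
    (hp.const_mul (4 * C)).eventually_lt_const (show 4 * C * 0 < ε / 2 by simpa using hε)]
    with n hn1 hn2 hn3 hn4 hn5
  have hpn := hp0 n
  rw [dist_zero_right, Real.norm_of_nonneg (IsAdjacency.pathMass_nonneg hpn.le)]
  refine (pathMass_truncAdj_mono (G n) (r := 1 / p n) (by positivity) hM3 hpn.le).trans_lt ?_
  have h1 := IsAdjacency.pathMass_nonneg (b := truncAdj (G n) (1 / p n) M) hpn.le
  have h2 := (isAdjacency_truncAdj (G n) (1 / p n) M).edgeMass_nonneg (p n)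
  have h3 := (edgeMass_truncAdj_le (G n) (1 / p n) M (p n)).trans hn1
  set S := pathMass (truncAdj (G n) (1 / p n) M) (p n)
  set m := edgeMass (truncAdj (G n) (1 / p n) M) (p n)
  have h4 := (abs_lt.1 hn2).1
  have h5 := (abs_lt.1 hn3).2
  -- Subtracting the mean from the variance leaves `S / 2 < ε / 4 + 2 * C * p n`, hence `S < ε`.
  have h6 : S / 2 ≤ (1 - p n) * S := by nlinarith
  have h7 : m - 2 * (C * p n) ≤ m * (1 - p n) ^ 2 := by
    have e1 : m * p n ≤ C * p n := mul_le_mul_of_nonneg_right h3 hpn.le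
    have e2 : 0 ≤ m * p n ^ 2 := by positivity
    nlinarith
  linarith

end Equivalences

end

end BernoulliQuadratic

/-! ### The cycle of implications. -/

theorem corollary1p4
    -- graphs on the vertices `1, …, n`, labelled in non-increasing order of the degrees
    (G : (n : ℕ) → SimpleGraph (Fin n))
    (hG : ∀ n, ∀ u v : Fin n, u ≤ v →
      BernoulliQuadratic.deg (G n) v ≤ BernoulliQuadratic.deg (G n) u)
    -- the sparse regime
    (p : ℕ → I) (hp_pos : ∀ n, 0 < (p n : ℝ))
    (hp : Tendsto (fun n => (p n : ℝ)) atTop (𝓝 0))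
    (hsparse : (fun n => ((G n).edgeSet.ncard : ℝ) * (p n : ℝ) ^ 2) =Θ[atTop] fun _ => (1 : ℝ))
    -- for every `n`, i.i.d. Bernoulli variables with parameter `p n`
    {Ω : ℕ → Type*} [∀ n, MeasurableSpace (Ω n)] (P : (n : ℕ) → Measure (Ω n))
    [∀ n, IsProbabilityMeasure (P n)]
    (X : (n : ℕ) → Fin n → Ω n → ℝ)
    (hX : ∀ n v, HasLaw (X n v) (bernoulliMeasure (1 : ℝ) 0 (p n)) (P n))
    (hindep : ∀ n, iIndepFun (X n) (P n))
    (lam : ℝ≥0) :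
    List.TFAE [
      TendstoInDistribution
        (fun n ω => BernoulliQuadratic.quadForm (G n) (fun v => X n v ω)) atTop
        (fun k : ℕ => (k : ℝ)) P (poissonMeasure lam),
      BernoulliQuadratic.DoubleLimit
          (fun M n => ∫ ω, BernoulliQuadratic.truncQuadForm (G n) (1 / (p n : ℝ)) M
            (fun v => X n v ω) ∂(P n)) lam ∧
        BernoulliQuadratic.DoubleLimit
          (fun M n => variance (fun ω => BernoulliQuadratic.truncQuadForm (G n) (1 / (p n : ℝ)) M
            (fun v => X n v ω)) (P n)) lam,
      BernoulliQuadratic.LimitHypotheses G (fun n => 1 / (p n : ℝ))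
        (fun _ _ => 0) (fun _ => 0) lam] := by
  have hfam : ∀ n, BernoulliQuadratic.IsBernoulliFamily (p n : ℝ) (X n) (P n) := fun n =>
    BernoulliQuadratic.isBernoulliFamily_of_hasLaw (hX n) (hindep n)
  have hp1 : ∀ n, (p n : ℝ) ≤ 1 := fun n => (p n).2.2
  obtain ⟨C, hC0, hC⟩ : ∃ C : ℝ, 0 ≤ C ∧ ∀ᶠ n in atTop,
      BernoulliQuadratic.edgeMass (BernoulliQuadratic.adj (G n)) (p n) ≤ C := by
    obtain ⟨C, hC0, hC⟩ := hsparse.1.exists_pos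
    refine ⟨C, hC0.le, ?_⟩
    filter_upwards [hC.bound] with n hn
    rw [BernoulliQuadratic.edgeMass_adj]
    simpa using (le_abs_self _).trans hn
  have hmean : ∀ M n, ∫ ω, BernoulliQuadratic.truncQuadForm (G n) (1 / (p n : ℝ)) M
      (fun v => X n v ω) ∂(P n)
      = BernoulliQuadratic.edgeMass (BernoulliQuadratic.truncAdj (G n) (1 / (p n : ℝ)) M) (p n) :=
    fun M n => by
      simp only [BernoulliQuadratic.truncQuadForm_eq]
      exact (hfam n).integral_matrixForm (BernoulliQuadratic.isAdjacency_truncAdj _ _ _)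
  have hvar : ∀ M n, variance (fun ω => BernoulliQuadratic.truncQuadForm (G n) (1 / (p n : ℝ)) M
      (fun v => X n v ω)) (P n)
      = (1 - p n) * BernoulliQuadratic.pathMass
          (BernoulliQuadratic.truncAdj (G n) (1 / (p n : ℝ)) M) (p n)
        + BernoulliQuadratic.edgeMass (BernoulliQuadratic.truncAdj (G n) (1 / (p n : ℝ)) M) (p n)
          * (1 - p n) ^ 2 := fun M n => by
    simp only [BernoulliQuadratic.truncQuadForm_eq]
    exact (hfam n).variance_matrixForm (BernoulliQuadratic.isAdjacency_truncAdj _ _ _)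
  simp only [hmean, hvar]
  tfae_have 1 → 2 := by
    intro hT
    have h1 : ∀ ε > 0, ∀ᶠ M in atTop, ∀ᶠ n in atTop, |BernoulliQuadratic.edgeMass
        (BernoulliQuadratic.truncAdj (G n) (1 / (p n : ℝ)) M) (p n) - lam| < ε := by
      intro ε hε
      have h := BernoulliQuadratic.eventually_abs_integral_pow_sub_lt hfam hp_pos hC hT
        (k := 1) (by norm_num) (BernoulliQuadratic.integrable_poisson_one lam) hε
      rw [BernoulliQuadratic.integral_poisson_one] at h
      simpa only [pow_one, (hfam _).integral_matrixForm
        (BernoulliQuadratic.isAdjacency_truncAdj _ _ _)] using h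
    refine ⟨BernoulliQuadratic.doubleLimit_iff.2 h1, BernoulliQuadratic.doubleLimit_iff.2 ?_⟩
    intro ε hε
    have hl : (0 : ℝ) ≤ lam := lam.2
    -- Chosen so that `|m ^ 2 - lam ^ 2| = |m - lam| * (m + lam)` is at most `ε / 2` when `0 ≤ m ≤
    -- C`. The variance is then compared through the second moment, whose limit is `lam ^ 2 + lam`.
    have hδ : 0 < ε / (2 * (C + lam + 1)) := by positivity
    have h2 := BernoulliQuadratic.eventually_abs_integral_pow_sub_lt hfam hp_pos hC hT
      (k := 2) le_rfl (BernoulliQuadratic.integrable_poisson_two lam) (half_pos hε)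
    rw [BernoulliQuadratic.integral_poisson_two] at h2
    simp only [(hfam _).integral_matrixForm_sq
      (BernoulliQuadratic.isAdjacency_truncAdj _ _ _)] at h2
    filter_upwards [h1 _ hδ, h2] with M hM1 hM2
    filter_upwards [hC, hM1, hM2] with n hn1 hn2 hn3
    have h3 := (BernoulliQuadratic.edgeMass_truncAdj_le (G n) (1 / (p n : ℝ)) M (p n)).trans hn1
    have h4 := (BernoulliQuadratic.isAdjacency_truncAdj (G n) (1 / (p n : ℝ)) M).edgeMass_nonneg
      (p n)
    set S := BernoulliQuadratic.pathMass (BernoulliQuadratic.truncAdj (G n) (1 / (p n : ℝ)) M) (p n)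
    set m := BernoulliQuadratic.edgeMass (BernoulliQuadratic.truncAdj (G n) (1 / (p n : ℝ)) M) (p n)
    have h5 : |m ^ 2 - (lam : ℝ) ^ 2| ≤ ε / 2 := by
      have e1 : m ^ 2 - (lam : ℝ) ^ 2 = (m - lam) * (m + lam) := by ring
      rw [e1, abs_mul, abs_of_nonneg (add_nonneg h4 hl)]
      calc |m - lam| * (m + lam) ≤ ε / (2 * (C + lam + 1)) * (C + lam + 1) := by
            refine mul_le_mul hn2.le (by linarith) (by positivity) hδ.le
        _ = ε / 2 := by field_simp
    rw [abs_lt] at hn3 ⊢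
    rw [abs_le] at h5
    constructor <;> linarith [hn3.1, hn3.2, h5.1, h5.2]
  tfae_have 2 → 3 := by
    rintro ⟨h1, h2⟩
    rw [BernoulliQuadratic.doubleLimit_iff] at h1 h2
    exact BernoulliQuadratic.limitHypotheses_of_tendsto_pathMass hG hp_pos hC
      (fun M _ => BernoulliQuadratic.tendsto_pathMass_of_variance hp_pos hp hC h1 h2 M) h1
  tfae_have 3 → 1 := fun h =>
    BernoulliQuadratic.tendstoInDistribution_of_tendsto_pathMass hfam hp_pos hp1 hC
      (fun M _ => BernoulliQuadratic.tendsto_pathMass_of_limitHypotheses hG hp_pos hC hC0 h M)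
      (fun _ hε => BernoulliQuadratic.eventually_edgeMass_of_limitHypotheses hG hp_pos hC h hε)
  tfae_finish
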